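/- Let $d\in\mathbb N$, $\mathbb T^d=(\mathbb R/2\pi\mathbb Z)^d$, $\varphi_k(x)=(2\pi)^{-d/2}e^{ikx}$ and $\lambda_k=|k|^2$ for $k\in\mathbb Z^d$. All function spaces consist of real-valued functions; $H^1(\mathbb T^d)=\{w\in L^2(\mathbb T^d):\sum_k\lambda_k|\langle w,\varphi_k\rangle|^2<\infty\}$ with $\|w\|_{H^1}^2=\|w\|_{L^2}^2+\sum_k\lambda_k|\langle w,\varphi_k\rangle|^2$, and $H^1\times L^2(\mathbb T^d)$ carries the norm $\|(w,v)\|^2=\|w\|_{H^1}^2+\|v\|_{L^2}^2$. Consider the bilinear wave equation $$\partial_t^2 w(x,t)=\Big(\Delta+\sum_{j=0}^{2d}p_j(t)\mu_j(x)\Big)w(x,t),\qquad (\mu_0,\dots,\mu_{2d})=(1,\cos x_1,\sin x_1,\dots,\cos x_d,\sin x_d),$$ with control $p=(p_0,\dots,p_{2d})$. For a piecewise constant $p:[0,\tau]\to\mathbb R^{2d+1}$, a solution on $[0,\tau]$ with initial state $W_0=(w_0,\dot w_0)$ is a function $W=(w,\partial_t w)\in C^0([0,\tau],H^1\times L^2(\mathbb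 T^d))$ such that, for all $t\in[0,\tau]$, $$W(t)=e^{t\mathcal A}W_0+\int_0^t e^{(t-s)\mathcal A}\Big(\sum_{j=0}^{2d}p_j(s)\mu_j\,\mathcal B\Big)W(s)\,ds,\qquad \mathcal A=\begin{pmatrix}0&I\\ \Delta&0\end{pmatrix},\quad \mathcal B=\begin{pmatrix}0&0\\ I&0\end{pmatrix},$$ where $e^{t\mathcal A}$ is the free wave evolution, given by its Fourier series. **Proposition.** Let $(w_0,\dot w_0)\in H^1\times L^2(\mathbb T^d)$ be such that $w_0\neq0$ and $\langle w_0,e^{ikx}\rangle_{L^2}=0$ for all but finitely many $k\in\mathbb Z^d$, and let $f\in L^2(\mathbb T^d)$. Then for all $\varepsilon,T>0$ there exist a time $\tau\in[0,T)$ and a piecewise constant control $p:[0,\tau]\to\mathbb R^{2d+1}$ such that a solution on $[0,\tau]$ with initial state $(w_0,\dot w_0)$ and control $p$ exists, and every such solution satisfies $$\Big\|\big(w(\cdot,\tau),\partial_t w(\cdot,\tau)\big)-(w_0,f)\Big\|_{H^1\times L^2(\mathbb T^d)}<\varepsilon .$$ -/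

import Mathlib

open MeasureTheory Set Filter Topology
open scoped Real ENNReal BigOperators

namespace BilinearWave

noncomputable section

/-! ### The torus, its Fourier modes, and `L²` -/

instance instFactTwoPi : Fact (0 < 2 * π) := ⟨Real.two_pi_pos⟩

/-- The `d`-dimensional torus `(ℝ / 2πℤ)^d`; its `volume` is the product of the Lebesgue measures of
the factors, so that the total mass is `(2π)^d`. -/
abbrev Torus (d : ℕ) : Type := Fin d → AddCircle (2 * π)

/-- The function `x ↦ e^{ikx}` on the torus, for `k ∈ ℤ^d`. -/
def expMode {d : ℕ} (k : Fin d → ℤ) : C(Torus d, ℂ) where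
  toFun x := ∏ i, fourier (k i) (x i)
  continuous_toFun := by fun_prop

/-- The `L²`-normalised eigenfunction `φ_k(x) = (2π)^{-d/2} e^{ikx}` of `-Δ`. -/
def phi {d : ℕ} (k : Fin d → ℤ) : C(Torus d, ℂ) :=
  (((2 * π) ^ (-(d : ℝ) / 2) : ℝ) : ℂ) • expMode k

/-- The eigenvalue `λ_k = |k|²` of `-Δ`. -/
def eigen {d : ℕ} (k : Fin d → ℤ) : ℝ := ∑ i, (k i : ℝ) ^ 2

/-- Real-valued square integrable functions on the torus. -/
abbrev L2 (d : ℕ) : Type := Lp ℝ 2 (volume : Measure (Torus d))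

/-- The Fourier coefficient `⟨w, φ_k⟩ = ∫ w \overline{φ_k}`. -/
def coeff {d : ℕ} (w : L2 d) (k : Fin d → ℤ) : ℂ :=
  ∫ x, ((w x : ℝ) : ℂ) * (starRingEnd ℂ) (phi k x)

theorem eigen_nonneg {d : ℕ} (k : Fin d → ℤ) : 0 ≤ eigen k :=
  Finset.sum_nonneg fun _ _ => sq_nonneg _

theorem integrable_mul_mode {d : ℕ} (w : L2 d) (k : Fin d → ℤ) :
    Integrable (fun x => ((w x : ℝ) : ℂ) * (starRingEnd ℂ) (phi k x)) := by
  have h1 : Integrable (fun x => ((w x : ℝ) : ℂ)) :=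
    ((Lp.memLp w).integrable (by norm_num)).ofReal
  refine h1.mul_bdd (c := ‖phi k‖) ?_ ?_
  · exact (Complex.continuous_conj.comp (phi k).continuous).aestronglyMeasurable
  · refine Eventually.of_forall fun x => ?_
    rw [RCLike.norm_conj]
    exact (phi k).norm_coe_le_norm x

theorem coeff_add {d : ℕ} (v w : L2 d) (k : Fin d → ℤ) :
    coeff (v + w) k = coeff v k + coeff w k := by
  unfold coeff
  rw [← integral_add (integrable_mul_mode v k) (integrable_mul_mode w k)]
  refine integral_congr_ae ?_
  filter_upwards [Lp.coeFn_add v w] with x hx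
  rw [hx]
  simp [add_mul]

theorem coeff_smul {d : ℕ} (c : ℝ) (w : L2 d) (k : Fin d → ℤ) :
    coeff (c • w) k = c • coeff w k := by
  unfold coeff
  rw [← integral_smul]
  refine integral_congr_ae ?_
  filter_upwards [Lp.coeFn_smul c w] with x hx
  rw [hx]
  simp [mul_assoc]

/-! ### The Sobolev space `H¹` -/

/-- The weighted coefficient family `k ↦ √λ_k ⟨w, φ_k⟩`, depending linearly on `w`. -/
def gradCoeff (d : ℕ) : L2 d →ₗ[ℝ] ((Fin d → ℤ) → ℂ) where
  toFun w k := Real.sqrt (eigen k) • coeff w k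
  map_add' v w := by
    funext k
    simp [coeff_add]
  map_smul' c w := by
    funext k
    simp only [coeff_smul, RingHom.id_apply, Pi.smul_apply]
    rw [smul_comm]

theorem memlp_gradCoeff_iff {d : ℕ} (w : L2 d) :
    Memℓp (gradCoeff d w) 2 ↔ Summable fun k => eigen k * ‖coeff w k‖ ^ 2 := by
  rw [memℓp_gen_iff (by norm_num)]
  refine summable_congr fun k => ?_
  simp [gradCoeff, mul_pow, Real.sq_sqrt (eigen_nonneg k)]

/-- `H¹` as a linear subspace of `L²`: the functions with `∑ λ_k |⟨w, φ_k⟩|² < ∞`. -/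
def H1sub (d : ℕ) : Submodule ℝ (L2 d) where
  carrier := {w | Summable fun k => eigen k * ‖coeff w k‖ ^ 2}
  add_mem' := by
    intro v w hv hw
    simp only [mem_ofPred_eq, ← memlp_gradCoeff_iff] at hv hw ⊢
    rw [map_add]
    exact hv.add hw
  zero_mem' := by
    simp only [mem_ofPred_eq, ← memlp_gradCoeff_iff, map_zero]
    exact zero_memℓp
  smul_mem' := by
    intro c w hw
    simp only [mem_ofPred_eq, ← memlp_gradCoeff_iff] at hw ⊢
    rw [map_smul]
    exact hw.const_smul c

/-- The Sobolev space `H¹` of real-valued functions, with its own norm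
`‖w‖² = ‖w‖²_{L²} + ∑ λ_k |⟨w, φ_k⟩|²` (it is a separate type because, as a subspace of `L²`,
`H1sub` already carries the `L²` norm). -/
def H1 (d : ℕ) : Type := H1sub d

instance instAddCommGroupH1 (d : ℕ) : AddCommGroup (H1 d) :=
  inferInstanceAs (AddCommGroup (H1sub d))

instance instModuleH1 (d : ℕ) : Module ℝ (H1 d) :=
  inferInstanceAs (Module ℝ (H1sub d))

/-- The inclusion `H¹ → L²`. -/
def H1.incl (d : ℕ) : H1 d →ₗ[ℝ] L2 d := (H1sub d).subtype

/-- An `L²` function satisfying the summability condition, as an element of `H¹`. -/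
def H1.mk {d : ℕ} (w : L2 d) (hw : Summable fun k => eigen k * ‖coeff w k‖ ^ 2) : H1 d :=
  (⟨w, hw⟩ : H1sub d)

theorem H1.incl_injective (d : ℕ) : Function.Injective (H1.incl d) :=
  (H1sub d).injective_subtype

theorem H1.memlp {d : ℕ} (w : H1 d) : Memℓp (gradCoeff d (H1.incl d w)) 2 :=
  (memlp_gradCoeff_iff _).2 w.2

/-- The map `w ↦ (w, (√λ_k ⟨w, φ_k⟩)_k)` into the Hilbert space `L² ⊕ ℓ²`, whose norm `H¹` carries. -/
def H1.embed (d : ℕ) : H1 d →ₗ[ℝ] WithLp 2 (L2 d × lp (fun _ : Fin d → ℤ => ℂ) 2) where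
  toFun w := WithLp.toLp 2 (H1.incl d w, ⟨gradCoeff d (H1.incl d w), H1.memlp w⟩)
  map_add' v w := by
    rw [← WithLp.toLp_add]
    congr 1
    exact Prod.ext (map_add _ v w) (Subtype.ext
      ((congrArg (gradCoeff d) (map_add (H1.incl d) v w)).trans (map_add (gradCoeff d) _ _)))
  map_smul' c w := by
    rw [RingHom.id_apply, ← WithLp.toLp_smul]
    congr 1
    exact Prod.ext (map_smul _ c w) (Subtype.ext
      ((congrArg (gradCoeff d) (map_smul (H1.incl d) c w)).trans (map_smul (gradCoeff d) _ _)))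

theorem H1.embed_injective (d : ℕ) : Function.Injective (H1.embed d) := fun _ _ h =>
  H1.incl_injective d (congrArg (fun z => (WithLp.ofLp z).1) h)

instance instNormedAddCommGroupH1 (d : ℕ) : NormedAddCommGroup (H1 d) :=
  NormedAddCommGroup.induced (H1 d) _ (H1.embed d) (H1.embed_injective d)

instance instNormedSpaceH1 (d : ℕ) : NormedSpace ℝ (H1 d) :=
  NormedSpace.induced ℝ (H1 d) _ (H1.embed d)

theorem H1.norm_sq {d : ℕ} (w : H1 d) :
    ‖w‖ ^ 2 = ‖H1.incl d w‖ ^ 2 + ∑' k, eigen k * ‖coeff (H1.incl d w) k‖ ^ 2 := by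
  have h0 : ‖w‖ = ‖H1.embed d w‖ := rfl
  rw [h0, WithLp.prod_norm_sq_eq_of_L2]
  congr 1
  have h := lp.norm_rpow_eq_tsum (p := 2) (by norm_num)
    (⟨gradCoeff d (H1.incl d w), H1.memlp w⟩ : lp (fun _ : Fin d → ℤ => ℂ) 2)
  simp only [ENNReal.toReal_ofNat, Real.rpow_ofNat] at h
  refine h.trans (tsum_congr fun k => ?_)
  simp [gradCoeff, mul_pow, Real.sq_sqrt (eigen_nonneg k)]

/-! ### Fourier components of real functions -/

theorem integral_expMode {d : ℕ} {k : Fin d → ℤ} (hk : k ≠ 0) : ∫ x, expMode k x = 0 := by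
  obtain ⟨i, hi⟩ := Function.ne_iff.mp hk
  have h1 : ∫ x, expMode k x = ∏ i, ∫ y : AddCircle (2 * π), fourier (k i) y :=
    integral_fintype_prod_volume_eq_prod (fun i (y : AddCircle (2 * π)) => fourier (k i) y)
  rw [h1]
  refine Finset.prod_eq_zero (Finset.mem_univ i) ?_
  exact integral_eq_zero_of_add_right_eq_neg
    (fourier_add_half_inv_index hi Real.two_pi_pos)

theorem expMode_mul_conj {d : ℕ} (k j : Fin d → ℤ) (x : Torus d) :
    expMode k x * (starRingEnd ℂ) (expMode j x) = expMode (k - j) x := by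
  simp only [expMode, ContinuousMap.coe_mk, map_prod, ← Finset.prod_mul_distrib]
  refine Finset.prod_congr rfl fun i _ => ?_
  rw [← fourier_neg, ← fourier_add, Pi.sub_apply, sub_eq_add_neg]

theorem conj_expMode {d : ℕ} (k : Fin d → ℤ) (x : Torus d) :
    (starRingEnd ℂ) (expMode k x) = expMode (-k) x := by
  simp only [expMode, ContinuousMap.coe_mk, map_prod, Pi.neg_apply, fourier_neg]

/-- The real function `Re (⟨w, φ_k⟩ φ_k)`, as an element of `L²`. As `w` is real, for every real
multiplier with `m_{-k} = m_k` one has `∑ m_k ⟨w, φ_k⟩ φ_k = ∑ m_k Re (⟨w, φ_k⟩ φ_k)`. -/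
def part {d : ℕ} (w : L2 d) (k : Fin d → ℤ) : L2 d :=
  ContinuousMap.toLp 2 volume ℝ
    (⟨fun x => (coeff w k * phi k x).re, by fun_prop⟩ : C(Torus d, ℝ))

theorem coeff_part_eq_zero {d : ℕ} (w : L2 d) {k j : Fin d → ℤ} (h1 : k ≠ j) (h2 : -k ≠ j) :
    coeff (part w k) j = 0 := by
  set r : ℂ := (((2 * π) ^ (-(d : ℝ) / 2) : ℝ) : ℂ) with hr
  have key : ∀ x : Torus d,
      (((coeff w k * phi k x).re : ℝ) : ℂ) * (starRingEnd ℂ) (phi j x)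
        = coeff w k * r * r / 2 * expMode (k - j) x
          + (starRingEnd ℂ) (coeff w k) * r * r / 2 * expMode (-k - j) x := by
    intro x
    have hp : ∀ i : Fin d → ℤ, phi i x = r * expMode i x := fun i => rfl
    have hrr : (starRingEnd ℂ) r = r := Complex.conj_ofReal _
    rw [Complex.re_eq_add_conj, hp, hp, map_mul, map_mul, map_mul, hrr, conj_expMode k,
      ← expMode_mul_conj, ← expMode_mul_conj]
    ring
  have hc : coeff (part w k) j
      = ∫ x, (((coeff w k * phi k x).re : ℝ) : ℂ) * (starRingEnd ℂ) (phi j x) := by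
    refine integral_congr_ae ?_
    filter_upwards [ContinuousMap.coeFn_toLp (p := 2) (𝕜 := ℝ) (volume : Measure (Torus d))
      (⟨fun x => (coeff w k * phi k x).re, by fun_prop⟩ : C(Torus d, ℝ))] with x hx
    rw [part, hx]
    rfl
  have hint : ∀ i : Fin d → ℤ, Integrable (fun x : Torus d => expMode i x) := fun i =>
    (expMode i).continuous.integrable_of_hasCompactSupport (HasCompactSupport.of_compactSpace _)
  rw [hc, integral_congr_ae (Eventually.of_forall key),
    integral_add ((hint _).const_mul _) ((hint _).const_mul _), integral_const_mul,
    integral_const_mul, integral_expMode (sub_ne_zero.2 h1), integral_expMode (sub_ne_zero.2 h2)]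
  simp

theorem summable_part {d : ℕ} (w : L2 d) (k : Fin d → ℤ) :
    Summable fun j => eigen j * ‖coeff (part w k) j‖ ^ 2 := by
  refine summable_of_ne_finset_zero (s := {k, -k}) fun j hj => ?_
  simp only [Finset.mem_insert, Finset.mem_singleton, not_or] at hj
  rw [coeff_part_eq_zero w (Ne.symm hj.1) (Ne.symm hj.2)]
  simp

/-- The real function `Re (⟨w, φ_k⟩ φ_k)`, as an element of `H¹`. -/
def partH1 {d : ℕ} (w : L2 d) (k : Fin d → ℤ) : H1 d := H1.mk (part w k) (summable_part w k)

/-! ### The free evolution -/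

/-- The function `sin(√λ_k t) / √λ_k`, with the value `t` for `k = 0`. -/
def sinc {d : ℕ} (t : ℝ) (k : Fin d → ℤ) : ℝ :=
  if k = 0 then t else Real.sin (√(eigen k) * t) / √(eigen k)

/-- The free evolution `e^{tA}(w, v)`, `A = (0, I; Δ, 0)`, given by the Fourier series of the
solution of the wave equation: the profile is summed in `H¹` and the velocity in `L²`. -/
def freeFlow {d : ℕ} (t : ℝ) (W : H1 d × L2 d) : H1 d × L2 d :=
  (∑' k : Fin d → ℤ,
      (Real.cos (√(eigen k) * t) • partH1 (H1.incl d W.1) k + sinc t k • partH1 W.2 k),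
    ∑' k : Fin d → ℤ,
      (-(√(eigen k) * Real.sin (√(eigen k) * t)) • part (H1.incl d W.1) k
        + Real.cos (√(eigen k) * t) • part W.2 k))

/-! ### The controlled wave equation -/

/-- The spatial control functions `(μ_0, …, μ_{2d}) = (1, cos x_1, sin x_1, …, cos x_d, sin x_d)`:
for `i : Fin d`, the entries `2i + 1` and `2i + 2` are the real and the imaginary part of the `i`-th
coordinate function `e^{i x}`. -/
def lowMode (d : ℕ) (j : Fin (2 * d + 1)) : C(Torus d, ℝ) :=
  if hj : j.val = 0 then 1
  else if j.val % 2 = 1 then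
    ⟨fun x => (fourier 1 (x ⟨(j.val - 1) / 2, by omega⟩) : ℂ).re, by fun_prop⟩
  else
    ⟨fun x => (fourier 1 (x ⟨(j.val - 1) / 2, by omega⟩) : ℂ).im, by fun_prop⟩

/-- The potential `∑ p_j μ_j` of a control value `p ∈ ℝ^{2d+1}`. -/
def potential {d : ℕ} (p : Fin (2 * d + 1) → ℝ) : C(Torus d, ℝ) := ∑ j, p j • lowMode d j

theorem memLp_mul {d : ℕ} (m : C(Torus d, ℝ)) (w : L2 d) :
    MemLp (fun x => m x * w x) 2 (volume : Measure (Torus d)) := by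
  refine MemLp.of_le_mul (c := ‖m‖) (Lp.memLp w)
    (m.continuous.aestronglyMeasurable.mul (Lp.aestronglyMeasurable w))
    (Eventually.of_forall fun x => ?_)
  rw [norm_mul]
  gcongr
  exact m.norm_coe_le_norm x

/-- Multiplication of an `L²` function by a continuous function. -/
def mulL2 {d : ℕ} (m : C(Torus d, ℝ)) (w : L2 d) : L2 d := (memLp_mul m w).toLp _

/-- The control operator `(∑ p_j μ_j) B`, with `B (w, v) = (0, w)`. -/
def controlOp {d : ℕ} (p : Fin (2 * d + 1) → ℝ) (W : H1 d × L2 d) : H1 d × L2 d :=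
  (0, mulL2 (potential p) (H1.incl d W.1))

/-- `W` is a weak (mild) solution on `[0, τ]` of
`∂_t W = (A + ∑ p_j(t) μ_j B) W`, `W(0) = W₀`: a continuous curve in `H¹ × L²` with
`W(t) = e^{tA} W₀ + ∫_0^t e^{(t-s)A} (∑ p_j(s) μ_j B) W(s) ds` in `H¹ × L²` for all `t ∈ [0, τ]`.
Its components are the profile `w` and the velocity `∂_t w` of the wave with
`∂_t² w = (Δ + ∑ p_j(t) μ_j) w`. -/
structure IsWeakSolution {d : ℕ} (τ : ℝ) (p : ℝ → Fin (2 * d + 1) → ℝ) (W₀ : H1 d × L2 d)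
    (W : ℝ → H1 d × L2 d) : Prop where
  continuousOn : ContinuousOn W (Icc 0 τ)
  integrable : ∀ t ∈ Icc 0 τ,
    IntervalIntegrable (fun s => freeFlow (t - s) (controlOp (p s) (W s))) volume 0 t
  duhamel : ∀ t ∈ Icc 0 τ,
    W t = freeFlow t W₀ + ∫ s in (0 : ℝ)..t, freeFlow (t - s) (controlOp (p s) (W s))

/-- `p` is piecewise constant on `[0, τ]`: there is a finite subdivision `0 = t_0 < … < t_N = τ`
such that `p` is constant on every open interval `(t_i, t_{i+1})`. -/
def IsPiecewiseConstant {E : Type*} (τ : ℝ) (p : ℝ → E) : Prop :=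
  ∃ (N : ℕ) (t : Fin (N + 1) → ℝ), StrictMono t ∧ t 0 = 0 ∧ t (Fin.last N) = τ ∧
    ∀ i : Fin N, ∃ c : E, ∀ s ∈ Ioo (t i.castSucc) (t i.succ), p s = c

end

end BilinearWave

namespace BilinearWave

noncomputable section

/-! ### Fourier series on the torus -/

/-! A control of size `1/δ` held for a short time `δ` overwhelms the free dynamics and acts like the
exponential of K = m B, where m is a potential and B (w, v) = (0, w). Since K² = 0, this exponential
is 1 + K: the profile w stays fixed and the velocity jumps by m w. Every combination of the control
functions is thus a "kick" available in arbitrarily small time (`Impulse.of_control`).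

Further kicks come from conjugation. Kick by m/r, evolve freely for time r², kick by -m/r. The first
kick makes the profile drift by about r m w; the second kick sees this drift and leaves the velocity
v - m² w, while all other terms vanish as r → 0 (`tendsto_conj_kick`). So -m² is a kick whenever all
multiples of m are and m multiplies H¹ into itself. The sign is forced, but since the constant 1 is
a control function and cos² + sin² = 1, squares of modes are obtained with both signs
(`mul_self_mem_kickSpace`), and polarization gives products (`mul_mem_kickSpace`). By the addition
formulas the frequencies l for which cos(l·x) and sin(l·x) are kicks form a subgroup of ℤ^d. It
contains the standard basis, hence is everything (`mem_kickFrequencies`).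

At the fixed profile w₀ the velocity can therefore be changed by any element of the span of cos(l·x)
w₀ and sin(l·x) w₀. A function h orthogonal to this span satisfies w₀ h = 0, because all Fourier
coefficients of the product vanish. As w₀ is a nonzero trigonometric polynomial, its zeros form a
null set, so h = 0. The span is dense and every f can be approached (`reachIn_velocity`).

The approximations compose because each step is a flow depending continuously on its initial state
(`ReachIn.trans`). Uniqueness of mild solutions (`IsMild.unique`) carries the estimate from the
constructed solution to every solution. -/

theorem norm_expMode_apply {d : ℕ} (k : Fin d → ℤ) (x : Torus d) : ‖expMode k x‖ = 1 := by
  simp only [expMode, ContinuousMap.coe_mk, fourier_apply, norm_prod, Circle.norm_coe,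
    Finset.prod_const_one]

theorem expMode_add {d : ℕ} (k l : Fin d → ℤ) : expMode (k + l) = expMode k * expMode l := by
  ext x
  simp [expMode, Finset.prod_mul_distrib]

theorem expMode_zero {d : ℕ} : expMode (0 : Fin d → ℤ) = 1 := by
  ext x
  simp [expMode]

theorem expMode_single {d : ℕ} (i : Fin d) (x : Torus d) :
    expMode (Pi.single i 1) x = fourier 1 (x i) := by
  have h : ∀ j : Fin d, fourier ((Pi.single i (1 : ℤ) : Fin d → ℤ) j) (x j)
      = if j = i then (fourier 1 (x i) : ℂ) else 1 := by
    intro j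
    split_ifs with hj
    · subst hj; simp only [Pi.single_eq_same]
    · simp only [Pi.single_eq_of_ne hj, fourier_zero]
  simp only [expMode, ContinuousMap.coe_mk, h]
  simp

theorem phi_apply {d : ℕ} (k : Fin d → ℤ) (x : Torus d) :
    phi k x = (((2 * π) ^ (-(d : ℝ) / 2) : ℝ) : ℂ) * expMode k x := rfl

theorem conj_phi {d : ℕ} (k : Fin d → ℤ) (x : Torus d) :
    (starRingEnd ℂ) (phi k x) = phi (-k) x := by
  rw [phi_apply, phi_apply, map_mul, Complex.conj_ofReal, conj_expMode]

theorem expMode_mul_phi {d : ℕ} (k l : Fin d → ℤ) (x : Torus d) :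
    expMode k x * phi l x = phi (k + l) x := by
  rw [phi_apply, phi_apply, expMode_add, ContinuousMap.mul_apply]
  ring

theorem integral_phi_mul_conj {d : ℕ} (k j : Fin d → ℤ) :
    ∫ x, phi k x * (starRingEnd ℂ) (phi j x) = if k = j then 1 else 0 := by
  set r : ℝ := (2 * π) ^ (-(d : ℝ) / 2) with hr
  have h : ∀ x : Torus d, phi k x * (starRingEnd ℂ) (phi j x)
      = ((r : ℂ) * r) * expMode (k - j) x := by
    intro x
    rw [phi_apply, phi_apply, map_mul, Complex.conj_ofReal, ← expMode_mul_conj]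
    ring
  simp_rw [h]
  rw [integral_const_mul]
  split_ifs with hkj
  · subst hkj
    have hvol : (volume : Measure (Torus d)).real univ = (2 * π) ^ d := by
      rw [measureReal_def, ← Set.pi_univ univ, volume_pi_pi]
      simp [AddCircle.measure_univ, Real.pi_pos.le]
    have hone : ∫ x : Torus d, expMode (k - k) x = (((2 * π) ^ d : ℝ) : ℂ) := by
      rw [sub_self, expMode_zero]
      simp only [ContinuousMap.one_apply, integral_const, hvol]
      simp
    rw [hone, ← Complex.ofReal_mul, ← Complex.ofReal_mul, ← Complex.ofReal_one]
    congr 1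
    have h2 : (2 * π) ^ (d : ℕ) = (2 * π) ^ (d : ℝ) := (Real.rpow_natCast _ _).symm
    rw [hr, h2, ← Real.rpow_add Real.two_pi_pos, ← Real.rpow_add Real.two_pi_pos]
    ring_nf
    exact Real.rpow_zero _
  · rw [integral_expMode (sub_ne_zero.2 hkj), mul_zero]

/-- The star subalgebra of `C(Torus d, ℂ)` generated by the exponentials. -/
def expModeSubalgebra (d : ℕ) : StarSubalgebra ℂ C(Torus d, ℂ) where
  toSubalgebra := Algebra.adjoin ℂ (range expMode)
  star_mem' := by
    change Algebra.adjoin ℂ (range expMode) ≤ star (Algebra.adjoin ℂ (range expMode))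
    refine Algebra.adjoin_le ?_
    rintro _ ⟨k, rfl⟩
    refine Algebra.subset_adjoin ⟨-k, ?_⟩
    ext1 x
    exact (conj_expMode k x).symm

theorem expModeSubalgebra_coe (d : ℕ) :
    (expModeSubalgebra d).toSubalgebra.toSubmodule = Submodule.span ℂ (range expMode) := by
  apply Algebra.adjoin_eq_span_of_subset
  refine .trans (fun x ↦ Submonoid.closure_induction (fun _ ↦ id) ⟨0, expMode_zero⟩ ?_)
    Submodule.subset_span
  rintro _ _ _ _ ⟨m, rfl⟩ ⟨n, rfl⟩
  exact ⟨m + n, expMode_add m n⟩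

theorem expModeSubalgebra_separatesPoints (d : ℕ) : (expModeSubalgebra d).SeparatesPoints := by
  intro x y hxy
  obtain ⟨i, hi⟩ := Function.ne_iff.mp hxy
  refine ⟨_, ⟨expMode (Pi.single i 1), Algebra.subset_adjoin ⟨Pi.single i 1, rfl⟩, rfl⟩, ?_⟩
  dsimp only
  rw [expMode_single, expMode_single, fourier_one, fourier_one]
  exact fun h => hi (AddCircle.injective_toCircle Real.two_pi_pos.ne' (Subtype.ext h))

/-- Stone–Weierstrass: products and conjugates of exponentials are exponentials, so their span is
already a star subalgebra. -/
theorem span_expMode_closure_eq_top (d : ℕ) :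
    (Submodule.span ℂ (range (expMode (d := d)))).topologicalClosure = ⊤ := by
  rw [← expModeSubalgebra_coe]
  exact congr_arg (Subalgebra.toSubmodule <| StarSubalgebra.toSubalgebra ·)
    (ContinuousMap.starSubalgebra_topologicalClosure_eq_top_of_separatesPoints _
      (expModeSubalgebra_separatesPoints d))

/-- The functions `φ_k` as elements of the complex `L²` space. -/
def phiLp {d : ℕ} (k : Fin d → ℤ) : Lp ℂ 2 (volume : Measure (Torus d)) :=
  ContinuousMap.toLp 2 volume ℂ (phi k)

theorem coeFn_phiLp {d : ℕ} (k : Fin d → ℤ) : phiLp k =ᵐ[volume] phi k :=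
  ContinuousMap.coeFn_toLp volume (phi k)

theorem orthonormal_phiLp (d : ℕ) : Orthonormal ℂ (phiLp (d := d)) := by
  rw [orthonormal_iff_ite]
  intro k j
  rw [phiLp, phiLp, ContinuousMap.inner_toLp]
  have h := integral_phi_mul_conj j k
  simp only [@eq_comm _ j k] at h
  exact h

theorem span_phiLp_closure_eq_top (d : ℕ) :
    (Submodule.span ℂ (range (phiLp (d := d)))).topologicalClosure = ⊤ := by
  have h1 : (Submodule.span ℂ (range fun k : Fin d → ℤ =>
      (ContinuousMap.toLp 2 volume ℂ (expMode k) : Lp ℂ 2 (volume : Measure (Torus d))))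
      ).topologicalClosure = ⊤ := by
    simpa only [Submodule.map_span, ContinuousLinearMap.coe_coe, ← range_comp,
      Function.comp_def] using
      (ContinuousMap.toLp_denseRange (p := 2) ℂ (volume : Measure (Torus d)) ℂ
        (by norm_num)).topologicalClosure_map_submodule (span_expMode_closure_eq_top d)
  rw [eq_top_iff, ← h1]
  refine Submodule.topologicalClosure_mono (Submodule.span_le.2 ?_)
  rintro _ ⟨k, rfl⟩
  have hr : (((2 * π) ^ (-(d : ℝ) / 2) : ℝ) : ℂ) ≠ 0 :=
    Complex.ofReal_ne_zero.2 (Real.rpow_pos_of_pos Real.two_pi_pos _).ne'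
  have h2 : (ContinuousMap.toLp 2 volume ℂ (expMode k) : Lp ℂ 2 (volume : Measure (Torus d)))
      = (((2 * π) ^ (-(d : ℝ) / 2) : ℝ) : ℂ)⁻¹ • phiLp k := by
    rw [phiLp, phi, map_smul, smul_smul, inv_mul_cancel₀ hr, one_smul]
  simp only [SetLike.mem_coe]
  rw [h2]
  exact Submodule.smul_mem _ _ (Submodule.subset_span ⟨k, rfl⟩)

/-- The Hilbert basis `(φ_k)` of the complex `L²` space. -/
def phiBasis (d : ℕ) : HilbertBasis (Fin d → ℤ) ℂ (Lp ℂ 2 (volume : Measure (Torus d))) :=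
  HilbertBasis.mk (orthonormal_phiLp d) (span_phiLp_closure_eq_top d).ge

/-- A real square integrable function as a complex one. -/
def toComplex {d : ℕ} (w : L2 d) : Lp ℂ 2 (volume : Measure (Torus d)) :=
  ((Lp.memLp w).ofReal (K := ℂ)).toLp _

theorem coeFn_toComplex {d : ℕ} (w : L2 d) :
    toComplex w =ᵐ[volume] fun x => ((w x : ℝ) : ℂ) := MemLp.coeFn_toLp _

theorem norm_toComplex {d : ℕ} (w : L2 d) : ‖toComplex w‖ = ‖w‖ := by
  rw [toComplex, Lp.norm_toLp, Lp.norm_def]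
  congr 1
  exact eLpNorm_congr_norm_ae (Eventually.of_forall fun x => by simp)

theorem phiBasis_repr_apply {d : ℕ} (z : Lp ℂ 2 (volume : Measure (Torus d))) (k : Fin d → ℤ) :
    (phiBasis d).repr z k = ∫ x, z x * (starRingEnd ℂ) (phi k x) := by
  rw [HilbertBasis.repr_apply_apply, phiBasis, HilbertBasis.coe_mk, L2.inner_def]
  refine integral_congr_ae ?_
  filter_upwards [coeFn_phiLp k] with x hx
  rw [hx]
  rfl

theorem repr_toComplex {d : ℕ} (w : L2 d) (k : Fin d → ℤ) :
    (phiBasis d).repr (toComplex w) k = coeff w k := by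
  rw [phiBasis_repr_apply]
  refine integral_congr_ae ?_
  filter_upwards [coeFn_toComplex w] with x hx
  rw [hx]

/-- Parseval's identity. -/
theorem hasSum_norm_coeff_sq {d : ℕ} (w : L2 d) :
    HasSum (fun k => ‖coeff w k‖ ^ 2) (‖w‖ ^ 2) := by
  have h := lp.hasSum_norm (p := 2) (by norm_num) ((phiBasis d).repr (toComplex w))
  simpa [repr_toComplex, norm_toComplex] using h

theorem coeff_neg_index {d : ℕ} (w : L2 d) (k : Fin d → ℤ) :
    coeff w (-k) = (starRingEnd ℂ) (coeff w k) := by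
  rw [coeff, coeff, ← integral_conj]
  congr 1
  ext x
  rw [map_mul, Complex.conj_conj, Complex.conj_ofReal, conj_phi, neg_neg]

/-- The Riesz–Fischer theorem for real functions. -/
theorem exists_coeff_eq {d : ℕ} (c : (Fin d → ℤ) → ℂ) (hc : Summable fun k => ‖c k‖ ^ 2)
    (hsymm : ∀ k, c (-k) = (starRingEnd ℂ) (c k)) : ∃ u : L2 d, ∀ k, coeff u k = c k := by
  have hmem : Memℓp c 2 := by
    rw [memℓp_gen_iff (by norm_num)]
    simpa using hc
  set z := (phiBasis d).repr.symm ⟨c, hmem⟩ with hz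
  have hzc : ∀ k, ∫ x, z x * (starRingEnd ℂ) (phi k x) = c k := fun k => by
    rw [← phiBasis_repr_apply, hz, LinearIsometryEquiv.apply_symm_apply]
  have hint : ∀ k : Fin d → ℤ, Integrable fun x => z x * (starRingEnd ℂ) (phi k x) := fun k => by
    refine ((Lp.memLp z).integrable (by norm_num)).mul_bdd (c := ‖phi k‖)
      (Complex.continuous_conj.comp (phi k).continuous).aestronglyMeasurable
      (Eventually.of_forall fun x => ?_)
    rw [RCLike.norm_conj]
    exact (phi k).norm_coe_le_norm x
  -- The k-th coefficient of Re z is (c_k + conj c_{-k}) / 2, which the symmetry of c turns into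
  -- c_k.
  refine ⟨((Lp.memLp z).re).toLp _, fun k => ?_⟩
  have h1 : coeff (((Lp.memLp z).re).toLp _) k
      = ∫ x, (z x * (starRingEnd ℂ) (phi k x)
        + (starRingEnd ℂ) (z x * (starRingEnd ℂ) (phi (-k) x))) / 2 := by
    refine integral_congr_ae ?_
    filter_upwards [MemLp.coeFn_toLp (Lp.memLp z).re] with x hx
    rw [hx, map_mul, Complex.conj_conj, ← conj_phi, RCLike.re_eq_complex_re,
      Complex.re_eq_add_conj]
    ring
  have hconj : Integrable fun x => (starRingEnd ℂ) (z x * (starRingEnd ℂ) (phi (-k) x)) :=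
    Complex.conjCLE.toContinuousLinearMap.integrable_comp (hint (-k))
  rw [h1, integral_div,
    integral_add (hint k) hconj, integral_conj, hzc, hzc, hsymm, Complex.conj_conj]
  ring

theorem coeff_sub {d : ℕ} (v w : L2 d) (k : Fin d → ℤ) :
    coeff (v - w) k = coeff v k - coeff w k := by
  have h := coeff_add (v - w) w k
  rw [sub_add_cancel] at h
  exact eq_sub_of_add_eq h.symm

theorem coeff_zero {d : ℕ} (k : Fin d → ℤ) : coeff (0 : L2 d) k = 0 := by
  have h := coeff_smul 0 (0 : L2 d) k
  rwa [zero_smul, zero_smul] at h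

theorem coeff_sum {d : ℕ} {ι : Type*} (s : Finset ι) (f : ι → L2 d) (k : Fin d → ℤ) :
    coeff (∑ i ∈ s, f i) k = ∑ i ∈ s, coeff (f i) k := by
  classical
  induction s using Finset.induction_on with
  | empty => simp [coeff_zero]
  | insert a s ha ih => rw [Finset.sum_insert ha, Finset.sum_insert ha, coeff_add, ih]

theorem ext_coeff {d : ℕ} {v w : L2 d} (h : ∀ k, coeff v k = coeff w k) : v = w := by
  have h1 := hasSum_norm_coeff_sq (v - w)
  simp only [coeff_sub, h, sub_self, norm_zero, ne_eq, OfNat.ofNat_ne_zero, not_false_eq_true,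
    zero_pow] at h1
  have h2 := h1.unique hasSum_zero
  exact sub_eq_zero.1 (norm_eq_zero.1 (pow_eq_zero_iff two_ne_zero |>.1 h2))

theorem eigen_neg {d : ℕ} (k : Fin d → ℤ) : eigen (-k) = eigen k := by
  simp [eigen]

theorem one_le_eigen {d : ℕ} {k : Fin d → ℤ} (hk : k ≠ 0) : 1 ≤ eigen k := by
  obtain ⟨i, hi⟩ := Function.ne_iff.mp hk
  have h1 : (1 : ℝ) ≤ (k i : ℝ) ^ 2 := by
    have : (1 : ℤ) ≤ (k i) ^ 2 := by
      have := sq_pos_of_ne_zero (show k i ≠ 0 from hi)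
      omega
    exact_mod_cast this
  exact h1.trans (Finset.single_le_sum (f := fun i => (k i : ℝ) ^ 2)
    (fun _ _ => sq_nonneg _) (Finset.mem_univ i))

theorem summable_H1 {d : ℕ} (w : H1 d) :
    Summable fun k => eigen k * ‖coeff (H1.incl d w) k‖ ^ 2 := w.2

theorem H1.hasSum_norm_sq {d : ℕ} (w : H1 d) :
    HasSum (fun k => (1 + eigen k) * ‖coeff (H1.incl d w) k‖ ^ 2) (‖w‖ ^ 2) := by
  rw [H1.norm_sq]
  simp only [add_mul, one_mul]
  exact (hasSum_norm_coeff_sq _).add (summable_H1 w).hasSum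

theorem exists_H1_coeff_eq {d : ℕ} (c : (Fin d → ℤ) → ℂ)
    (hc : Summable fun k => (1 + eigen k) * ‖c k‖ ^ 2)
    (hsymm : ∀ k, c (-k) = (starRingEnd ℂ) (c k)) :
    ∃ u : H1 d, ∀ k, coeff (H1.incl d u) k = c k := by
  obtain ⟨u, hu⟩ := exists_coeff_eq c (Summable.of_nonneg_of_le (fun _ => by positivity)
    (fun k => by nlinarith [eigen_nonneg k, sq_nonneg ‖c k‖]) hc) hsymm
  refine ⟨H1.mk u (Summable.of_nonneg_of_le
    (fun k => mul_nonneg (eigen_nonneg k) (sq_nonneg _))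
    (fun k => ?_) hc), hu⟩
  rw [hu]
  nlinarith [sq_nonneg ‖c k‖]

theorem H1.ext_coeff {d : ℕ} {v w : H1 d}
    (h : ∀ k, coeff (H1.incl d v) k = coeff (H1.incl d w) k) : v = w :=
  H1.incl_injective d (BilinearWave.ext_coeff h)

theorem H1.norm_incl_le {d : ℕ} (w : H1 d) : ‖H1.incl d w‖ ≤ ‖w‖ := by
  refine le_of_sq_le_sq ?_ (norm_nonneg _)
  exact hasSum_le (fun k => by nlinarith [eigen_nonneg k, sq_nonneg ‖coeff (H1.incl d w) k‖])
    (hasSum_norm_coeff_sq _) (H1.hasSum_norm_sq w)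

/-- Dominated convergence for Fourier series in `L²`. -/
theorem tendsto_zero_of_coeff {d : ℕ} {ι : Type*} {l : Filter ι} {z : ι → L2 d}
    {G : (Fin d → ℤ) → ℝ} (hG : Summable G) (hle : ∀ᶠ i in l, ∀ k, ‖coeff (z i) k‖ ^ 2 ≤ G k)
    (hlim : ∀ k, Tendsto (fun i => coeff (z i) k) l (𝓝 0)) : Tendsto z l (𝓝 0) := by
  have h := tendsto_tsum_of_dominated_convergence (𝓕 := l)
    (f := fun i k => ‖coeff (z i) k‖ ^ 2) (g := fun _ => 0) hG
    (fun k => by simpa using ((hlim k).norm.pow 2))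
    (by filter_upwards [hle] with i hi k; simpa using hi k)
  simp only [tsum_zero, (hasSum_norm_coeff_sq _).tsum_eq] at h
  rw [tendsto_zero_iff_norm_tendsto_zero]
  simpa [Real.sqrt_sq] using h.sqrt

/-- Dominated convergence for Fourier series in `H¹`. -/
theorem H1.tendsto_zero_of_coeff {d : ℕ} {ι : Type*} {l : Filter ι} {z : ι → H1 d}
    {G : (Fin d → ℤ) → ℝ} (hG : Summable G)
    (hle : ∀ᶠ i in l, ∀ k, (1 + eigen k) * ‖coeff (H1.incl d (z i)) k‖ ^ 2 ≤ G k)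
    (hlim : ∀ k, Tendsto (fun i => coeff (H1.incl d (z i)) k) l (𝓝 0)) : Tendsto z l (𝓝 0) := by
  have h := tendsto_tsum_of_dominated_convergence (𝓕 := l)
    (f := fun i k => (1 + eigen k) * ‖coeff (H1.incl d (z i)) k‖ ^ 2) (g := fun _ => 0) hG
    (fun k => by simpa using ((hlim k).norm.pow 2).const_mul (1 + eigen k))
    (by
      filter_upwards [hle] with i hi k
      rw [Real.norm_of_nonneg (mul_nonneg (by linarith [eigen_nonneg k]) (sq_nonneg _))]
      exact hi k)
  simp only [tsum_zero, (H1.hasSum_norm_sq _).tsum_eq] at h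
  rw [tendsto_zero_iff_norm_tendsto_zero]
  simpa [Real.sqrt_sq] using h.sqrt

/-- The multiplier (1 + λ_k)^{-1/2} is an isometry of L² onto H¹, so completeness is inherited. The
contraction and uniform boundedness arguments on H¹ × L² depend on it. -/
instance instCompleteSpaceH1 (d : ℕ) : CompleteSpace (H1 d) := by
  have hpos : ∀ k : Fin d → ℤ, 0 < 1 + eigen k := fun k => by linarith [eigen_nonneg k]
  have hex : ∀ u : L2 d, ∃ w : H1 d, ∀ k,
      coeff (H1.incl d w) k = (√(1 + eigen k))⁻¹ • coeff u k := fun u => by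
    refine exists_H1_coeff_eq _ ((hasSum_norm_coeff_sq u).summable.congr fun k => ?_) fun k => ?_
    · rw [norm_smul, mul_pow, norm_inv, inv_pow, Real.norm_of_nonneg (Real.sqrt_nonneg _),
        Real.sq_sqrt (hpos k).le, mul_inv_cancel_left₀ (hpos k).ne']
    · rw [eigen_neg, coeff_neg_index]
      simp
  choose J hJ using hex
  have hiso : Isometry J := by
    refine Isometry.of_dist_eq fun u v => ?_
    rw [dist_eq_norm, dist_eq_norm]
    refine (sq_eq_sq₀ (norm_nonneg _) (norm_nonneg _)).1 ?_
    refine (H1.hasSum_norm_sq (J u - J v)).unique ?_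
    convert hasSum_norm_coeff_sq (u - v) using 2 with k
    rw [map_sub, coeff_sub, hJ, hJ, ← smul_sub, ← coeff_sub, norm_smul, mul_pow, norm_inv, inv_pow,
      Real.norm_of_nonneg (Real.sqrt_nonneg _), Real.sq_sqrt (hpos k).le,
      mul_inv_cancel_left₀ (hpos k).ne']
  have hsurj : Function.Surjective J := fun w => by
    obtain ⟨u, hu⟩ := exists_coeff_eq (fun k => √(1 + eigen k) • coeff (H1.incl d w) k)
      ((H1.hasSum_norm_sq w).summable.congr fun k => by
        rw [norm_smul, mul_pow, Real.norm_of_nonneg (Real.sqrt_nonneg _),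
          Real.sq_sqrt (hpos k).le]) fun k => by
        rw [eigen_neg, coeff_neg_index]
        simp
    refine ⟨u, H1.ext_coeff fun k => ?_⟩
    rw [hJ, hu, smul_smul, inv_mul_cancel₀ (Real.sqrt_pos.2 (hpos k)).ne', one_smul]
  exact (hiso.isUniformInducing.completeSpace_congr hsurj).1 inferInstance

/-! ### Mild solutions of bilinear evolution equations in a Banach space -/

/-- A strongly continuous group of bounded operators. -/
structure IsStrongGroup {X : Type*} [NormedAddCommGroup X] [NormedSpace ℝ X]
    (S : ℝ → X →L[ℝ] X) : Prop where
  zero : ∀ x, S 0 x = x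
  add : ∀ s t x, S (s + t) x = S s (S t x)
  continuous : Continuous fun q : ℝ × X => S q.1 q.2

/-- `W` is a mild solution on `[0, τ]` of `W' = (A + K(t)) W`, `W(0) = W₀`, where `A` generates
the group `S`. -/
structure IsMild {X : Type*} [NormedAddCommGroup X] [NormedSpace ℝ X]
    (S : ℝ → X →L[ℝ] X) (τ : ℝ) (K : ℝ → X →L[ℝ] X) (W₀ : X) (W : ℝ → X) : Prop where
  continuousOn : ContinuousOn W (Icc 0 τ)
  integrable : ∀ t ∈ Icc 0 τ,
    IntervalIntegrable (fun s => S (t - s) (K s (W s))) volume 0 t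
  duhamel : ∀ t ∈ Icc 0 τ, W t = S t W₀ + ∫ s in (0 : ℝ)..t, S (t - s) (K s (W s))

section Mild

variable {X : Type*} [NormedAddCommGroup X] [NormedSpace ℝ X] {S : ℝ → X →L[ℝ] X}

theorem IsStrongGroup.exists_bound [CompleteSpace X] (hS : IsStrongGroup S) (τ : ℝ) :
    ∃ M, 0 < M ∧ ∀ t ∈ Icc 0 τ, ‖S t‖ ≤ M := by
  obtain ⟨M, hM⟩ := banach_steinhaus (g := fun t : Icc 0 τ => S t) fun x => by
    have hc : Continuous fun t : ℝ => S t x := hS.continuous.comp (continuous_id.prodMk continuous_const)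
    obtain ⟨C, hC⟩ := isCompact_Icc.exists_bound_of_continuousOn (s := Icc 0 τ) hc.continuousOn
    exact ⟨C, fun t => hC t t.2⟩
  exact ⟨max M 1, by positivity, fun t ht => (hM ⟨t, ht⟩).trans (le_max_left _ _)⟩

/-- A bounded function which is controlled by half of its supremum is small. -/
theorem norm_le_of_forall_bound {X : Type*} [NormedAddCommGroup X] {D : ℝ → X} {δ a : ℝ} (hD : ContinuousOn D (Icc 0 δ))
    (h : ∀ m, (∀ s ∈ Icc 0 δ, ‖D s‖ ≤ m) → ∀ t ∈ Icc 0 δ, ‖D t‖ ≤ a + m / 2) :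
    ∀ t ∈ Icc 0 δ, ‖D t‖ ≤ 2 * a := by
  intro t ht
  obtain ⟨r, hr, hmax⟩ := isCompact_Icc.exists_isMaxOn ⟨t, ht⟩ hD.norm
  -- With m the maximum of ‖D‖, attained at r, the hypothesis reads m ≤ a + m / 2.
  have h1 := h ‖D r‖ (fun s hs => hmax hs) r hr
  have h2 : ‖D t‖ ≤ ‖D r‖ := hmax ht
  linarith

theorem norm_integral_le_mul {f : ℝ → X} {C t : ℝ} (ht : 0 ≤ t)
    (h : ∀ s ∈ Icc 0 t, ‖f s‖ ≤ C) : ‖∫ s in (0 : ℝ)..t, f s‖ ≤ C * t := by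
  have := intervalIntegral.norm_integral_le_of_norm_le_const (a := 0) (b := t) (f := f) (C := C)
    fun s hs => h s (by rw [uIoc_of_le ht] at hs; exact ⟨hs.1.le, hs.2⟩)
  rwa [sub_zero, abs_of_nonneg ht] at this

theorem IsStrongGroup.continuous_conv (hS : IsStrongGroup S) {g : ℝ → X} (hg : Continuous g)
    (t : ℝ) : Continuous fun s => S (t - s) (g s) :=
  hS.continuous.comp (by fun_prop : Continuous fun s => (t - s, g s))

/-- By the group law `S t` leaves the integral, so that the remaining integrand is free of t and
continuity in t reduces to that of a primitive. -/
theorem IsStrongGroup.integral_conv [CompleteSpace X] (hS : IsStrongGroup S) {g : ℝ → X}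
    (hg : Continuous g) (t : ℝ) :
    ∫ s in (0 : ℝ)..t, S (t - s) (g s) = S t (∫ s in (0 : ℝ)..t, S (-s) (g s)) := by
  rw [← ContinuousLinearMap.intervalIntegral_comp_comm]
  · refine intervalIntegral.integral_congr fun s _ => ?_
    simp only [sub_eq_add_neg, hS.add]
  · have := (hS.continuous_conv hg 0).intervalIntegrable (μ := volume) 0 t
    simpa only [zero_sub] using this

theorem IsStrongGroup.continuous_integral_conv [CompleteSpace X] (hS : IsStrongGroup S)
    {g : ℝ → X} (hg : Continuous g) :
    Continuous fun t => ∫ s in (0 : ℝ)..t, S (t - s) (g s) := by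
  simp only [hS.integral_conv hg]
  have hc : Continuous fun s => S (-s) (g s) := by
    simpa only [zero_sub] using hS.continuous_conv hg 0
  exact hS.continuous.comp (continuous_id.prodMk
    (intervalIntegral.continuous_primitive (fun a b => hc.intervalIntegrable a b) 0))

/-- Short time existence for a constant bounded perturbation. -/
theorem IsStrongGroup.exists_isMild [CompleteSpace X] (hS : IsStrongGroup S) {δ M : ℝ}
    (hδ : 0 ≤ δ) (hM : ∀ t ∈ Icc 0 δ, ‖S t‖ ≤ M) (K : X →L[ℝ] X) (hK : δ * (M * ‖K‖) ≤ 1 / 2)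
    (W₀ : X) : ∃ W, IsMild S δ (fun _ => K) W₀ W := by
  have hg : ∀ f : C(Icc 0 δ, X), Continuous fun s => K (IccExtend hδ f s) := fun f =>
    K.continuous.comp f.continuous.Icc_extend'
  let F : C(Icc 0 δ, X) → C(Icc 0 δ, X) := fun f =>
    ⟨fun t => S t W₀ + ∫ s in (0 : ℝ)..t, S (t - s) (K (IccExtend hδ f s)),
      (hS.continuous.comp (by fun_prop : Continuous fun t : Icc 0 δ => ((t : ℝ), W₀))).add
        ((hS.continuous_integral_conv (hg f)).comp continuous_subtype_val)⟩
  -- The Duhamel map contracts with constant δ M ‖K‖ ≤ 1/2.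
  have hF : ContractingWith (1 / 2) F := by
    refine ⟨NNReal.half_lt_self one_ne_zero, LipschitzWith.of_dist_le_mul fun f f' => ?_⟩
    refine (ContinuousMap.dist_le (by positivity)).2 fun t => ?_
    rw [dist_eq_norm]
    change ‖(S t W₀ + ∫ s in (0 : ℝ)..t, S (t - s) (K (IccExtend hδ f s)))
      - (S t W₀ + ∫ s in (0 : ℝ)..t, S (t - s) (K (IccExtend hδ f' s)))‖ ≤ _
    rw [add_sub_add_left_eq_sub, ← intervalIntegral.integral_sub
      ((hS.continuous_conv (hg f) _).intervalIntegrable _ _)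
      ((hS.continuous_conv (hg f') _).intervalIntegrable _ _)]
    have h1 : ‖∫ s in (0 : ℝ)..t, (S (t - s) (K (IccExtend hδ f s))
        - S (t - s) (K (IccExtend hδ f' s)))‖ ≤ M * (‖K‖ * dist f f') * t := by
      refine norm_integral_le_mul t.2.1 fun s hs => ?_
      rw [← map_sub, ← map_sub]
      have hts : (t : ℝ) - s ∈ Icc 0 δ := ⟨by linarith [hs.2], by linarith [hs.1, t.2.2]⟩
      refine (ContinuousLinearMap.le_of_opNorm_le _ (hM _ hts) _).trans ?_
      refine mul_le_mul_of_nonneg_left ?_ ((norm_nonneg _).trans (hM _ hts))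
      refine (ContinuousLinearMap.le_opNorm _ _).trans ?_
      refine mul_le_mul_of_nonneg_left ?_ (norm_nonneg _)
      rw [← dist_eq_norm]
      exact ContinuousMap.dist_apply_le_dist _
    have hM0 : 0 ≤ M := (norm_nonneg _).trans (hM 0 ⟨le_rfl, hδ⟩)
    have h2 : M * (‖K‖ * dist f f') * t ≤ M * (‖K‖ * dist f f') * δ :=
      mul_le_mul_of_nonneg_left t.2.2 (by positivity)
    have h3 := mul_le_mul_of_nonneg_right hK (dist_nonneg (x := f) (y := f'))
    push_cast
    nlinarith
  obtain ⟨f, hf⟩ : ∃ f, F f = f := ⟨_, hF.fixedPoint_isFixedPt⟩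
  refine ⟨IccExtend hδ f, f.continuous.Icc_extend'.continuousOn,
    fun t _ => (hS.continuous_conv (hg f) t).intervalIntegrable _ _, fun t ht => ?_⟩
  rw [IccExtend_of_mem hδ f ht]
  exact (DFunLike.congr_fun hf ⟨t, ht⟩).symm

/-- Lipschitz dependence on the initial state for a short constant perturbation. -/
theorem IsMild.norm_sub_le {δ M : ℝ} (hM : ∀ t ∈ Icc 0 δ, ‖S t‖ ≤ M) {K : X →L[ℝ] X}
    (hK : δ * (M * ‖K‖) ≤ 1 / 2) {W₀ W₀' : X} {W W' : ℝ → X}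
    (hW : IsMild S δ (fun _ => K) W₀ W) (hW' : IsMild S δ (fun _ => K) W₀' W') :
    ∀ t ∈ Icc 0 δ, ‖W t - W' t‖ ≤ 2 * (M * ‖W₀ - W₀'‖) := by
  refine norm_le_of_forall_bound (hW.continuousOn.sub hW'.continuousOn) fun m hm t ht => ?_
  have hM0 : 0 ≤ M := (norm_nonneg _).trans (hM t ht)
  have hm0 : 0 ≤ m := (norm_nonneg _).trans (hm t ht)
  rw [hW.duhamel t ht, hW'.duhamel t ht, add_sub_add_comm, ← map_sub,
    ← intervalIntegral.integral_sub (hW.integrable t ht) (hW'.integrable t ht)]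
  have h1 : ‖∫ s in (0 : ℝ)..t, (S (t - s) (K (W s)) - S (t - s) (K (W' s)))‖
      ≤ M * (‖K‖ * m) * t := by
    refine norm_integral_le_mul ht.1 fun s hs => ?_
    rw [← map_sub, ← map_sub]
    have hts : (t : ℝ) - s ∈ Icc 0 δ := ⟨by linarith [hs.2], by linarith [hs.1, ht.2]⟩
    refine (ContinuousLinearMap.le_of_opNorm_le _ (hM _ hts) _).trans ?_
    refine mul_le_mul_of_nonneg_left ?_ hM0
    exact ContinuousLinearMap.le_opNorm_of_le _ (hm s ⟨hs.1, hs.2.trans ht.2⟩)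
  have h2 : M * (‖K‖ * m) * t ≤ M * (‖K‖ * m) * δ :=
    mul_le_mul_of_nonneg_left ht.2 (by positivity)
  have h3 := mul_le_mul_of_nonneg_right hK hm0
  have h4 := ContinuousLinearMap.le_of_opNorm_le _ (hM _ ht) (W₀ - W₀')
  refine (norm_add_le _ _).trans ?_
  nlinarith

/-- A perturbation `δ⁻¹ K` with `K² = 0` acts during a short time `δ` like `exp K = 1 + K`. -/
theorem IsMild.norm_sub_impulse_le [CompleteSpace X] {δ M η : ℝ} (hδ : 0 < δ)
    (hM : ∀ t ∈ Icc 0 δ, ‖S t‖ ≤ M) {K : X →L[ℝ] X} (hK : M * ‖K‖ ≤ 1 / 2)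
    (hKK : ∀ x, K (K x) = 0) {W₀ : X} {W : ℝ → X} (hW : IsMild S δ (fun _ => δ⁻¹ • K) W₀ W)
    (h1 : ∀ t ∈ Icc 0 δ, ‖S t W₀ - W₀‖ ≤ η) (h2 : ∀ t ∈ Icc 0 δ, ‖S t (K W₀) - K W₀‖ ≤ η) :
    ‖W δ - (W₀ + K W₀)‖ ≤ 4 * η := by
  -- The comparison curve W₀ + (t/δ) K W₀ solves W' = δ⁻¹ K W exactly, because K² = 0.
  have key : ∀ t ∈ Icc 0 δ, ‖W t - (W₀ + (t * δ⁻¹) • K W₀)‖ ≤ 2 * (2 * η) := by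
    refine norm_le_of_forall_bound
      (hW.continuousOn.sub (by fun_prop)) fun m hm t ht => ?_
    have hM0 : 0 ≤ M := (norm_nonneg _).trans (hM t ht)
    have hm0 : 0 ≤ m := (norm_nonneg _).trans (hm t ht)
    have hη0 : 0 ≤ η := (norm_nonneg _).trans (h1 t ht)
    have hconst : (t * δ⁻¹) • K W₀ = ∫ s in (0 : ℝ)..t, δ⁻¹ • K W₀ := by
      rw [intervalIntegral.integral_const, sub_zero, smul_smul]
    have hsplit : W t - (W₀ + (t * δ⁻¹) • K W₀) = (S t W₀ - W₀)
        + ∫ s in (0 : ℝ)..t, (S (t - s) ((δ⁻¹ • K) (W s)) - δ⁻¹ • K W₀) := by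
      rw [intervalIntegral.integral_sub (hW.integrable t ht)
        (continuous_const.intervalIntegrable _ _), ← hconst, hW.duhamel t ht]
      abel
    have h3 : ‖∫ s in (0 : ℝ)..t, (S (t - s) ((δ⁻¹ • K) (W s)) - δ⁻¹ • K W₀)‖
        ≤ (δ⁻¹ * (M * (‖K‖ * m) + η)) * t := by
      refine norm_integral_le_mul ht.1 fun s hs => ?_
      have hts : (t : ℝ) - s ∈ Icc 0 δ := ⟨by linarith [hs.2], by linarith [hs.1, ht.2]⟩
      -- K annihilates the term (s/δ) K W₀, so K may be applied to the full deviation from the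
      -- comparison curve.
      have e : S (t - s) ((δ⁻¹ • K) (W s)) - δ⁻¹ • K W₀
          = δ⁻¹ • (S (t - s) (K (W s - (W₀ + (s * δ⁻¹) • K W₀)))
            + (S (t - s) (K W₀) - K W₀)) := by
        simp only [FunLike.coe_smul, Pi.smul_apply, map_sub, map_add, map_smul, hKK, smul_zero,
          smul_sub, smul_add, map_zero]
        abel
      rw [e, norm_smul, norm_inv, Real.norm_of_nonneg hδ.le]
      refine mul_le_mul_of_nonneg_left ((norm_add_le _ _).trans (add_le_add ?_ (h2 _ hts)))
        (inv_nonneg.2 hδ.le)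
      refine (ContinuousLinearMap.le_of_opNorm_le _ (hM _ hts) _).trans ?_
      refine mul_le_mul_of_nonneg_left ?_ hM0
      exact ContinuousLinearMap.le_opNorm_of_le _ (hm s ⟨hs.1, hs.2.trans ht.2⟩)
    have h4 : (δ⁻¹ * (M * (‖K‖ * m) + η)) * t ≤ M * (‖K‖ * m) + η := by
      have : (δ⁻¹ * (M * (‖K‖ * m) + η)) * t ≤ (δ⁻¹ * (M * (‖K‖ * m) + η)) * δ :=
        mul_le_mul_of_nonneg_left ht.2 (by positivity)
      refine this.trans (le_of_eq ?_)
      field_simp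
    have h5 := mul_le_mul_of_nonneg_right hK hm0
    rw [hsplit]
    refine (norm_add_le _ _).trans ?_
    have := h1 t ht
    nlinarith
  have h := key δ ⟨hδ.le, le_rfl⟩
  rw [mul_inv_cancel₀ hδ.ne', one_smul] at h
  linarith

/-- Concatenation of mild solutions. -/
theorem IsMild.append [CompleteSpace X] (hS : IsStrongGroup S) {τ δ : ℝ} (hτ : 0 ≤ τ)
    {K₁ K₂ : ℝ → X →L[ℝ] X} {W₀ : X} {W₁ W₂ : ℝ → X} (h₁ : IsMild S τ K₁ W₀ W₁)
    (h₂ : IsMild S δ K₂ (W₁ τ) W₂) (hδ : 0 ≤ δ) :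
    IsMild S (τ + δ) (fun s => if s ≤ τ then K₁ s else K₂ (s - τ)) W₀
      (fun s => if s ≤ τ then W₁ s else W₂ (s - τ)) := by
  have hτ2 : W₂ 0 = W₁ τ := by
    have := h₂.duhamel 0 ⟨le_rfl, hδ⟩
    simpa [hS.zero] using this
  have hτmem : τ ∈ Icc 0 τ := ⟨hτ, le_rfl⟩
  have first : ∀ t' t : ℝ, 0 ≤ t → t ≤ τ → EqOn (fun s => S (t' - s)
      ((if s ≤ τ then K₁ s else K₂ (s - τ)) (if s ≤ τ then W₁ s else W₂ (s - τ))))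
      (fun s => S (t' - s) (K₁ s (W₁ s))) (uIoc 0 t) := by
    intro t' t h0 ht s hs
    rw [uIoc_of_le h0] at hs
    simp only [if_pos (hs.2.trans ht)]
  have second : ∀ t : ℝ, τ ≤ t → EqOn (fun s => S (t - s)
      ((if s ≤ τ then K₁ s else K₂ (s - τ)) (if s ≤ τ then W₁ s else W₂ (s - τ))))
      (fun s => S ((t - τ) - (s - τ)) (K₂ (s - τ) (W₂ (s - τ)))) (uIoc τ t) := by
    intro t ht s hs
    rw [uIoc_of_le ht] at hs
    simp only [if_neg (not_le.2 hs.1), sub_sub_sub_cancel_right]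
  -- The contribution of the first leg to the Duhamel integral at t is `S (t - τ)` applied to its
  -- value at τ.
  have first_eq : ∀ t : ℝ, EqOn (fun s => S (t - s) (K₁ s (W₁ s)))
      (fun s => S (t - τ) (S (τ - s) (K₁ s (W₁ s)))) (uIoc 0 τ) := by
    intro t s _
    simp only [← hS.add, sub_add_sub_cancel]
  have int1 : ∀ t : ℝ, IntervalIntegrable (fun s => S (t - s) (K₁ s (W₁ s))) volume 0 τ :=
    fun t => IntervalIntegrable.congr (first_eq t).symm
      ⟨(S (t - τ)).integrable_comp (h₁.integrable τ hτmem).1,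
        (S (t - τ)).integrable_comp (h₁.integrable τ hτmem).2⟩
  have int2 : ∀ t ∈ Icc τ (τ + δ), IntervalIntegrable
      (fun s => S ((t - τ) - (s - τ)) (K₂ (s - τ) (W₂ (s - τ)))) volume τ t := by
    intro t ht
    have := (h₂.integrable (t - τ) ⟨by linarith [ht.1], by linarith [ht.2]⟩).comp_sub_right τ
    simpa using this
  refine ⟨?_, fun t ht => ?_, fun t ht => ?_⟩
  · have hu : Icc 0 (τ + δ) = Icc 0 τ ∪ Icc τ (τ + δ) :=
      (Icc_union_Icc_eq_Icc hτ (by linarith)).symm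
    rw [hu]
    refine ContinuousOn.union_of_isClosed ?_ ?_ isClosed_Icc isClosed_Icc
    · exact h₁.continuousOn.congr fun s hs => by simp only [if_pos hs.2]
    · have hc : ContinuousOn (fun s => W₂ (s - τ)) (Icc τ (τ + δ)) :=
        h₂.continuousOn.comp (by fun_prop)
          fun s hs => ⟨by linarith [hs.1], by linarith [hs.2]⟩
      refine hc.congr fun s hs => ?_
      rcases hs.1.eq_or_lt with h | h
      · subst h; simp [hτ2]
      · simp only [if_neg (not_le.2 h)]
  · rcases le_total t τ with h | h
    · exact IntervalIntegrable.congr (first t t ht.1 h).symm (h₁.integrable t ⟨ht.1, h⟩)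
    · exact (IntervalIntegrable.congr (first t τ hτ le_rfl).symm (int1 t)).trans
        (IntervalIntegrable.congr (second t h).symm (int2 t ⟨h, ht.2⟩))
  · rcases le_or_gt t τ with h | h
    · simp only [if_pos h]
      rw [intervalIntegral.integral_congr_ae (Eventually.of_forall (first t t ht.1 h))]
      exact h₁.duhamel t ⟨ht.1, h⟩
    · simp only [if_neg (not_le.2 h)]
      rw [← intervalIntegral.integral_add_adjacent_intervals
        (IntervalIntegrable.congr (first t τ hτ le_rfl).symm (int1 t))
        (IntervalIntegrable.congr (second t h.le).symm (int2 t ⟨h.le, ht.2⟩)),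
        intervalIntegral.integral_congr_ae (Eventually.of_forall (first t τ hτ le_rfl)),
        intervalIntegral.integral_congr_ae (Eventually.of_forall (second t h.le)),
        intervalIntegral.integral_congr_ae (Eventually.of_forall (first_eq t)),
        ContinuousLinearMap.intervalIntegral_comp_comm _ (h₁.integrable τ hτmem),
        intervalIntegral.integral_comp_sub_right
          (fun s => S ((t - τ) - s) (K₂ s (W₂ s))) τ, sub_self, ← add_assoc]
      have e : S t W₀ = S (t - τ) (S τ W₀) := by rw [← hS.add, sub_add_cancel]
      rw [e, ← map_add, ← h₁.duhamel τ hτmem]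
      exact h₂.duhamel (t - τ) ⟨by linarith, by linarith [ht.2]⟩

/-- Uniqueness of mild solutions for bounded perturbations. -/
theorem IsMild.unique [CompleteSpace X] (hS : IsStrongGroup S) {τ C : ℝ} (hτ : 0 ≤ τ)
    {K : ℝ → X →L[ℝ] X} (hC : ∀ s, ‖K s‖ ≤ C) {W₀ : X} {W W' : ℝ → X}
    (hW : IsMild S τ K W₀ W) (hW' : IsMild S τ K W₀ W') : ∀ t ∈ Icc 0 τ, W t = W' t := by
  obtain ⟨M, hM0, hM⟩ := hS.exists_bound τ
  have hC0 : 0 ≤ C := (norm_nonneg _).trans (hC 0)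
  -- Extending the difference continuously to the line makes the primitive of ‖D‖ differentiable
  -- everywhere.
  set D : ℝ → X := IccExtend hτ ((Icc 0 τ).domRestrict fun s => W s - W' s) with hD
  have hDc : Continuous D :=
    (continuousOn_iff_continuous_domRestrict.1 (hW.continuousOn.sub hW'.continuousOn)).Icc_extend'
  have hDeq : ∀ t ∈ Icc 0 τ, D t = W t - W' t := fun t ht => by
    rw [hD, IccExtend_of_mem hτ _ ht]; rfl
  have hle : ∀ t ∈ Icc 0 τ, ‖D t‖ ≤ M * C * ∫ s in (0 : ℝ)..t, ‖D s‖ := by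
    intro t ht
    rw [hDeq t ht, hW.duhamel t ht, hW'.duhamel t ht, add_sub_add_left_eq_sub,
      ← intervalIntegral.integral_sub (hW.integrable t ht) (hW'.integrable t ht),
      ← intervalIntegral.integral_const_mul]
    refine intervalIntegral.norm_integral_le_of_norm_le ht.1
      (Eventually.of_forall fun s hs => ?_)
      ((continuous_const.mul hDc.norm).intervalIntegrable _ _)
    have hts : t - s ∈ Icc 0 τ := ⟨by linarith [hs.2], by linarith [hs.1, ht.2]⟩
    rw [← map_sub, ← map_sub, ← hDeq s ⟨hs.1.le, hs.2.trans ht.2⟩, mul_assoc]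
    refine (ContinuousLinearMap.le_of_opNorm_le _ (hM _ hts) _).trans ?_
    exact mul_le_mul_of_nonneg_left (ContinuousLinearMap.le_of_opNorm_le _ (hC _) _) hM0.le
  have hderiv : ∀ t, HasDerivAt (fun t => ∫ s in (0 : ℝ)..t, ‖D s‖) ‖D t‖ t := fun t =>
    hDc.norm.integral_hasStrictDerivAt 0 t |>.hasDerivAt
  -- Grönwall for the primitive of ‖D‖, which starts at 0 and whose derivative is at most M C times
  -- itself.
  have hzero := eq_zero_of_abs_deriv_le_mul_abs_self_of_eq_zero_right
    (f := fun t => ∫ s in (0 : ℝ)..t, ‖D s‖) (f' := fun t => ‖D t‖) (K := M * C) (a := 0) (b := τ)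
    (fun t _ => (hderiv t).continuousAt.continuousWithinAt)
    (fun t _ => (hderiv t).hasDerivWithinAt) (by simp) fun t ht => by
      rw [norm_norm, Real.norm_of_nonneg
        (intervalIntegral.integral_nonneg ht.1 fun _ _ => norm_nonneg _)]
      exact hle t ⟨ht.1, ht.2.le⟩
  intro t ht
  have h1 := hle t ht
  rw [hzero t ht, mul_zero] at h1
  rw [← sub_eq_zero, ← hDeq t ht]
  exact norm_le_zero_iff.1 h1

end Mild

/-! ### The free evolution in Fourier coefficients -/

/-- Re (c_k φ_k) is half the sum of the modes k and -k of w; at k = 0 the two halves fall on the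
same mode. -/
theorem coeff_part {d : ℕ} (w : L2 d) (k j : Fin d → ℤ) :
    coeff (part w k) j = ((if k = j then 1 else 0) + (if k = -j then 1 else 0)) / 2 * coeff w j := by
  have hint : ∀ i : Fin d → ℤ, Integrable fun x => phi i x * (starRingEnd ℂ) (phi j x) := fun i =>
    Continuous.integrable_of_hasCompactSupport
      ((phi i).continuous.mul (Complex.continuous_conj.comp (phi j).continuous))
      (HasCompactSupport.of_compactSpace _)
  have hc : coeff (part w k) j
      = ∫ x, (coeff w k / 2 * (phi k x * (starRingEnd ℂ) (phi j x))
        + coeff w (-k) / 2 * (phi (-k) x * (starRingEnd ℂ) (phi j x))) := by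
    refine integral_congr_ae ?_
    filter_upwards [ContinuousMap.coeFn_toLp (p := 2) (𝕜 := ℝ) (volume : Measure (Torus d))
      (⟨fun x => (coeff w k * phi k x).re, by fun_prop⟩ : C(Torus d, ℝ))] with x hx
    have hre : (((coeff w k * phi k x).re : ℝ) : ℂ)
        = (coeff w k * phi k x + coeff w (-k) * phi (-k) x) / 2 := by
      rw [Complex.re_eq_add_conj, map_mul, ← coeff_neg_index, conj_phi k]
    rw [part, hx]
    refine (congrArg (· * (starRingEnd ℂ) (phi j x)) hre).trans ?_
    ring
  rw [hc, integral_add ((hint _).const_mul _) ((hint _).const_mul _), integral_const_mul,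
    integral_const_mul, integral_phi_mul_conj, integral_phi_mul_conj]
  simp only [neg_eq_iff_eq_neg]
  have h1 : k = j → coeff w k = coeff w j := fun h => by rw [h]
  have h2 : k = -j → coeff w (-k) = coeff w j := fun h => by rw [h, neg_neg]
  split_ifs with h3 h4 h4
  · rw [h1 h3, h2 h4]; ring
  · rw [h1 h3]; ring
  · rw [h2 h4]; ring
  · ring

theorem coeff_sum_part {d : ℕ} (w : L2 d) (m : (Fin d → ℤ) → ℝ) (hm : ∀ k, m (-k) = m k)
    (s : Finset (Fin d → ℤ)) (j : Fin d → ℤ) :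
    coeff (∑ k ∈ s, m k • part w k) j
      = ((((if j ∈ s then 1 else 0) + (if -j ∈ s then 1 else 0)) / 2 : ℝ) : ℂ)
        * (m j • coeff w j) := by
  rw [coeff_sum]
  have h : ∀ k, coeff (m k • part w k) j = (if k = j then (m j / 2) • coeff w j else 0)
      + (if k = -j then (m j / 2) • coeff w j else 0) := by
    intro k
    rw [coeff_smul, coeff_part]
    have h1 : k = j → m k = m j := fun h => by rw [h]
    have h2 : k = -j → m k = m j := fun h => by rw [h, hm]
    split_ifs with h3 h4 h4
    · simp [h1 h3]; ring
    · simp [h1 h3]; ring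
    · simp [h2 h4]; ring
    · simp
  simp only [h, Finset.sum_add_distrib, Finset.sum_ite_eq']
  split_ifs <;> simp <;> ring

/-- A partial sum over an arbitrary finite set carries each mode with weight 0, 1/2 or 1, according
to how many of j, -j it contains. The error is therefore dominated by u itself, which permits
dominated convergence without symmetric summation. -/
theorem norm_coeff_sum_part_sub_le {d : ℕ} {w u : L2 d} {m : (Fin d → ℤ) → ℝ}
    (hm : ∀ k, m (-k) = m k) (hu : ∀ k, coeff u k = m k • coeff w k) (s : Finset (Fin d → ℤ))
    (j : Fin d → ℤ) : ‖coeff ((∑ k ∈ s, m k • part w k) - u) j‖ ≤ ‖coeff u j‖ := by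
  rw [coeff_sub, coeff_sum_part w m hm, ← hu]
  have h : ∀ r : ℝ, |r - 1| ≤ 1 → ‖(r : ℂ) * coeff u j - coeff u j‖ ≤ ‖coeff u j‖ := by
    intro r hr
    have e : (r : ℂ) * coeff u j - coeff u j = ((r - 1 : ℝ) : ℂ) * coeff u j := by
      push_cast; ring
    rw [e, norm_mul, Complex.norm_real]
    exact mul_le_of_le_one_left (norm_nonneg _) hr
  refine h _ ?_
  split_ifs <;> norm_num [abs_le]

theorem coeff_sum_part_sub_eventually {d : ℕ} {w u : L2 d} {m : (Fin d → ℤ) → ℝ}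
    (hm : ∀ k, m (-k) = m k) (hu : ∀ k, coeff u k = m k • coeff w k) (j : Fin d → ℤ) :
    Tendsto (fun s : Finset (Fin d → ℤ) => coeff ((∑ k ∈ s, m k • part w k) - u) j) atTop
      (𝓝 0) := by
  refine tendsto_const_nhds.congr' ?_
  filter_upwards [eventually_ge_atTop ({j, -j} : Finset (Fin d → ℤ))] with s hs
  have h1 : j ∈ s := hs (by simp)
  have h2 : -j ∈ s := hs (by simp)
  rw [coeff_sub, coeff_sum_part w m hm, ← hu, if_pos h1, if_pos h2]
  norm_num

/-- Fourier multipliers in `L²`. -/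
theorem hasSum_part {d : ℕ} {w u : L2 d} {m : (Fin d → ℤ) → ℝ}
    (hm : ∀ k, m (-k) = m k) (hu : ∀ k, coeff u k = m k • coeff w k) :
    HasSum (fun k => m k • part w k) u := by
  rw [HasSum, SummationFilter.unconditional_filter, ← tendsto_sub_nhds_zero_iff]
  refine tendsto_zero_of_coeff (hasSum_norm_coeff_sq u).summable
    (Eventually.of_forall fun s k => ?_) (coeff_sum_part_sub_eventually hm hu)
  exact pow_le_pow_left₀ (norm_nonneg _) (norm_coeff_sum_part_sub_le hm hu s k) 2

/-- Fourier multipliers in `H¹`. -/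
theorem hasSum_partH1 {d : ℕ} {w : L2 d} {u : H1 d} {m : (Fin d → ℤ) → ℝ}
    (hm : ∀ k, m (-k) = m k) (hu : ∀ k, coeff (H1.incl d u) k = m k • coeff w k) :
    HasSum (fun k => m k • partH1 w k) u := by
  have hincl : ∀ s : Finset (Fin d → ℤ), H1.incl d ((∑ k ∈ s, m k • partH1 w k) - u)
      = (∑ k ∈ s, m k • part w k) - H1.incl d u := fun s => by
    simp only [map_sub, map_sum, map_smul]
    rfl
  rw [HasSum, SummationFilter.unconditional_filter, ← tendsto_sub_nhds_zero_iff]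
  refine H1.tendsto_zero_of_coeff (H1.hasSum_norm_sq u).summable
    (Eventually.of_forall fun s k => ?_) fun k => ?_
  · rw [hincl]
    exact mul_le_mul_of_nonneg_left
      (pow_le_pow_left₀ (norm_nonneg _) (norm_coeff_sum_part_sub_le hm hu s k) 2)
      (by linarith [eigen_nonneg k])
  · simp only [hincl]
    exact coeff_sum_part_sub_eventually hm hu k

theorem norm_le_of_coeff {d : ℕ} {u w : L2 d} {C : ℝ} (hC : 0 ≤ C)
    (h : ∀ k, ‖coeff u k‖ ≤ C * ‖coeff w k‖) : ‖u‖ ≤ C * ‖w‖ := by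
  refine le_of_sq_le_sq ?_ (by positivity)
  rw [mul_pow]
  refine hasSum_le (fun k => ?_) (hasSum_norm_coeff_sq u) ((hasSum_norm_coeff_sq w).mul_left _)
  rw [← mul_pow]
  exact pow_le_pow_left₀ (norm_nonneg _) (h k) 2

theorem norm_le_of_coeff_H1_left {d : ℕ} {u : H1 d} {w : L2 d} {C : ℝ} (hC : 0 ≤ C)
    (h : ∀ k, (1 + eigen k) * ‖coeff (H1.incl d u) k‖ ^ 2 ≤ C ^ 2 * ‖coeff w k‖ ^ 2) :
    ‖u‖ ≤ C * ‖w‖ := by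
  refine le_of_sq_le_sq ?_ (by positivity)
  rw [mul_pow]
  exact hasSum_le h (H1.hasSum_norm_sq u) ((hasSum_norm_coeff_sq w).mul_left _)

theorem norm_le_of_coeff_H1_right {d : ℕ} {u : L2 d} {w : H1 d} {C : ℝ} (hC : 0 ≤ C)
    (h : ∀ k, ‖coeff u k‖ ≤ C * √(eigen k) * ‖coeff (H1.incl d w) k‖) :
    ‖u‖ ≤ C * ‖w‖ := by
  refine le_of_sq_le_sq ?_ (by positivity)
  rw [mul_pow]
  refine hasSum_le (fun k => ?_) (hasSum_norm_coeff_sq u) ((H1.hasSum_norm_sq w).mul_left _)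
  refine (pow_le_pow_left₀ (norm_nonneg _) (h k) 2).trans ?_
  rw [mul_pow, mul_pow, Real.sq_sqrt (eigen_nonneg k), mul_assoc]
  refine mul_le_mul_of_nonneg_left ?_ (sq_nonneg C)
  nlinarith [sq_nonneg ‖coeff (H1.incl d w) k‖]

theorem norm_le_of_coeff_H1 {d : ℕ} {u w : H1 d} {C : ℝ} (hC : 0 ≤ C)
    (h : ∀ k, ‖coeff (H1.incl d u) k‖ ≤ C * ‖coeff (H1.incl d w) k‖) : ‖u‖ ≤ C * ‖w‖ := by
  refine le_of_sq_le_sq ?_ (by positivity)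
  rw [mul_pow]
  refine hasSum_le (fun k => ?_) (H1.hasSum_norm_sq u) ((H1.hasSum_norm_sq w).mul_left _)
  have h1 := pow_le_pow_left₀ (norm_nonneg _) (h k) 2
  rw [mul_pow] at h1
  have h2 := eigen_nonneg k
  nlinarith

theorem eigen_zero {d : ℕ} : eigen (0 : Fin d → ℤ) = 0 := by simp [eigen]

theorem sinc_neg_index {d : ℕ} (t : ℝ) (k : Fin d → ℤ) : sinc t (-k) = sinc t k := by
  simp [sinc, eigen_neg]

theorem sqrt_eigen_pos {d : ℕ} {k : Fin d → ℤ} (hk : k ≠ 0) : 0 < √(eigen k) :=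
  Real.sqrt_pos.2 (zero_lt_one.trans_le (one_le_eigen hk))

theorem sqrt_eigen_mul_sinc {d : ℕ} (t : ℝ) (k : Fin d → ℤ) :
    √(eigen k) * sinc t k = Real.sin (√(eigen k) * t) := by
  by_cases hk : k = 0
  · simp [hk, eigen_zero]
  · rw [sinc, if_neg hk, mul_div_cancel₀ _ (sqrt_eigen_pos hk).ne']

theorem sinc_eq_mul {d : ℕ} (t : ℝ) (k : Fin d → ℤ) :
    sinc t k = t * Real.sinc (√(eigen k) * t) := by
  by_cases hk : k = 0
  · simp [hk, sinc, eigen_zero]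
  · rcases eq_or_ne t 0 with rfl | ht
    · simp [sinc, hk]
    · have h := (sqrt_eigen_pos hk).ne'
      rw [sinc, if_neg hk, Real.sinc_of_ne_zero (mul_ne_zero h ht)]
      field_simp

theorem abs_sinc_le {d : ℕ} (t : ℝ) (k : Fin d → ℤ) : |sinc t k| ≤ |t| := by
  rw [sinc_eq_mul, abs_mul]
  exact mul_le_of_le_one_right (abs_nonneg _) (Real.abs_sinc_le_one _)

/-- The derivative gained by the wave propagator: λ_k `sinc`² = sin² ≤ 1 and `sinc`² ≤ t², so an L²
velocity yields an H¹ profile. -/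
theorem one_add_eigen_mul_sinc_sq_le {d : ℕ} (t : ℝ) (k : Fin d → ℤ) :
    (1 + eigen k) * sinc t k ^ 2 ≤ (1 + |t|) ^ 2 := by
  have h1 : sinc t k ^ 2 ≤ t ^ 2 := sq_le_sq.2 (abs_sinc_le t k)
  have h2 : eigen k * sinc t k ^ 2 = Real.sin (√(eigen k) * t) ^ 2 := by
    rw [← sqrt_eigen_mul_sinc, mul_pow, Real.sq_sqrt (eigen_nonneg k)]
  have h3 := Real.sin_sq_le_one (√(eigen k) * t)
  nlinarith [abs_nonneg t, sq_abs t]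

/-- A linear bound suffices: at x = √λ_k t it gives a factor |t| at the price of one derivative. -/
theorem abs_one_sub_cos_le (x : ℝ) : |Real.cos x - 1| ≤ |x| := by
  have h1 := Real.one_sub_sq_div_two_le_cos (x := x)
  have h2 := Real.neg_one_le_cos x
  rw [abs_sub_comm, abs_of_nonneg (sub_nonneg.2 (Real.cos_le_one x))]
  rcases le_total |x| 2 with h | h
  · nlinarith [sq_abs x, abs_nonneg x]
  · linarith

/-- A `tsum` is 0 when the family is not summable, so the series in `freeFlow` say nothing until
summability is known. Each of the four multipliers is even in k and bounded in the relevant weights;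
Riesz–Fischer supplies its sum. -/
theorem freeFlow_aux {d : ℕ} (t : ℝ) (W : H1 d × L2 d) :
    (∀ k, coeff (H1.incl d (freeFlow t W).1) k
      = Real.cos (√(eigen k) * t) • coeff (H1.incl d W.1) k + sinc t k • coeff W.2 k) ∧
    ∀ k, coeff (freeFlow t W).2 k
      = -(√(eigen k) * Real.sin (√(eigen k) * t)) • coeff (H1.incl d W.1) k
        + Real.cos (√(eigen k) * t) • coeff W.2 k := by
  obtain ⟨w, v⟩ := W
  have hsq : ∀ (r : ℝ) (z : ℂ), ‖r • z‖ ^ 2 = r ^ 2 * ‖z‖ ^ 2 := fun r z => by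
    rw [norm_smul, mul_pow, Real.norm_eq_abs, sq_abs]
  have hsym : ∀ (m : (Fin d → ℤ) → ℝ) (u : L2 d), (∀ k, m (-k) = m k) →
      ∀ k, m (-k) • coeff u (-k) = (starRingEnd ℂ) (m k • coeff u k) := fun m u hm k => by
    rw [hm, coeff_neg_index]; simp
  have hw := (H1.hasSum_norm_sq w).summable
  have hv := (hasSum_norm_coeff_sq v).summable
  have e1 : ∀ k : Fin d → ℤ, Real.cos (√(eigen (-k)) * t) = Real.cos (√(eigen k) * t) :=
    fun k => by rw [eigen_neg]
  have e2 : ∀ k : Fin d → ℤ, -(√(eigen (-k)) * Real.sin (√(eigen (-k)) * t))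
      = -(√(eigen k) * Real.sin (√(eigen k) * t)) := fun k => by rw [eigen_neg]
  obtain ⟨u₁, hu₁⟩ := exists_H1_coeff_eq
    (fun k => Real.cos (√(eigen k) * t) • coeff (H1.incl d w) k)
    (Summable.of_nonneg_of_le
      (fun k => mul_nonneg (by linarith [eigen_nonneg k]) (sq_nonneg _)) (fun k => by
        rw [hsq]
        refine mul_le_mul_of_nonneg_left ?_ (by linarith [eigen_nonneg k])
        exact mul_le_of_le_one_left (sq_nonneg _) (Real.cos_sq_le_one _)) hw)
    (hsym (fun k => Real.cos (√(eigen k) * t)) _ e1)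
  obtain ⟨u₂, hu₂⟩ := exists_H1_coeff_eq (fun k => sinc t k • coeff v k)
    (Summable.of_nonneg_of_le
      (fun k => mul_nonneg (by linarith [eigen_nonneg k]) (sq_nonneg _)) (fun k => by
        rw [hsq, ← mul_assoc]
        exact mul_le_mul_of_nonneg_right (one_add_eigen_mul_sinc_sq_le t k) (sq_nonneg _))
      (hv.mul_left _)) (hsym (sinc t) _ (sinc_neg_index t))
  obtain ⟨u₃, hu₃⟩ := exists_coeff_eq
    (fun k => -(√(eigen k) * Real.sin (√(eigen k) * t)) • coeff (H1.incl d w) k)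
    (Summable.of_nonneg_of_le (fun k => sq_nonneg _) (fun k => by
        rw [hsq, neg_sq, mul_pow, Real.sq_sqrt (eigen_nonneg k)]
        have h1 := Real.sin_sq_le_one (√(eigen k) * t)
        refine mul_le_mul_of_nonneg_right ?_ (sq_nonneg _)
        nlinarith [eigen_nonneg k]) hw)
    (hsym (fun k => -(√(eigen k) * Real.sin (√(eigen k) * t))) _ e2)
  obtain ⟨u₄, hu₄⟩ := exists_coeff_eq (fun k => Real.cos (√(eigen k) * t) • coeff v k)
    (Summable.of_nonneg_of_le (fun k => sq_nonneg _) (fun k => by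
        rw [hsq]
        exact mul_le_of_le_one_left (sq_nonneg _) (Real.cos_sq_le_one _)) hv)
    (hsym (fun k => Real.cos (√(eigen k) * t)) _ e1)
  have h1 : (freeFlow t (w, v)).1 = u₁ + u₂ :=
    ((hasSum_partH1 e1 hu₁).add (hasSum_partH1 (sinc_neg_index t) hu₂)).tsum_eq
  have h2 : (freeFlow t (w, v)).2 = u₃ + u₄ :=
    ((hasSum_part e2 hu₃).add (hasSum_part e1 hu₄)).tsum_eq
  refine ⟨fun k => ?_, fun k => ?_⟩
  · rw [h1, map_add, coeff_add, hu₁, hu₂]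
  · rw [h2, coeff_add, hu₃, hu₄]

theorem coeff_freeFlow_fst {d : ℕ} (t : ℝ) (W : H1 d × L2 d) (k : Fin d → ℤ) :
    coeff (H1.incl d (freeFlow t W).1) k
      = Real.cos (√(eigen k) * t) • coeff (H1.incl d W.1) k + sinc t k • coeff W.2 k :=
  (freeFlow_aux t W).1 k

theorem coeff_freeFlow_snd {d : ℕ} (t : ℝ) (W : H1 d × L2 d) (k : Fin d → ℤ) :
    coeff (freeFlow t W).2 k
      = -(√(eigen k) * Real.sin (√(eigen k) * t)) • coeff (H1.incl d W.1) k
        + Real.cos (√(eigen k) * t) • coeff W.2 k :=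
  (freeFlow_aux t W).2 k

theorem ext_coeff_prod {d : ℕ} {V W : H1 d × L2 d}
    (h1 : ∀ k, coeff (H1.incl d V.1) k = coeff (H1.incl d W.1) k)
    (h2 : ∀ k, coeff V.2 k = coeff W.2 k) : V = W :=
  Prod.ext (H1.ext_coeff h1) (ext_coeff h2)

theorem freeFlow_add {d : ℕ} (t : ℝ) (V W : H1 d × L2 d) :
    freeFlow t (V + W) = freeFlow t V + freeFlow t W := by
  refine ext_coeff_prod (fun k => ?_) fun k => ?_
  · simp only [Prod.fst_add, Prod.snd_add, map_add, coeff_add, coeff_freeFlow_fst, smul_add]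
    ring
  · simp only [Prod.fst_add, Prod.snd_add, map_add, coeff_add, coeff_freeFlow_snd, smul_add]
    ring

theorem freeFlow_smul {d : ℕ} (t c : ℝ) (W : H1 d × L2 d) :
    freeFlow t (c • W) = c • freeFlow t W := by
  refine ext_coeff_prod (fun k => ?_) fun k => ?_
  · simp only [Prod.smul_fst, Prod.smul_snd, map_smul, coeff_smul, coeff_freeFlow_fst, smul_add]
    rw [smul_comm c, smul_comm c]
  · simp only [Prod.smul_fst, Prod.smul_snd, map_smul, coeff_smul, coeff_freeFlow_snd, smul_add]
    rw [smul_comm c, smul_comm c]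

theorem freeFlow_eq_add {d : ℕ} (t : ℝ) (W : H1 d × L2 d) :
    freeFlow t W = freeFlow t (W.1, 0) + freeFlow t (0, W.2) := by
  rw [← freeFlow_add]; simp

theorem coeff_incl_zero {d : ℕ} (k : Fin d → ℤ) : coeff (H1.incl d (0 : H1 d)) k = 0 := by
  rw [map_zero, coeff_zero]

theorem norm_freeFlow_profile_fst_le {d : ℕ} (t : ℝ) (w : H1 d) :
    ‖(freeFlow t (w, 0)).1‖ ≤ ‖w‖ := by
  rw [← one_mul ‖w‖]
  refine norm_le_of_coeff_H1 zero_le_one fun k => ?_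
  rw [coeff_freeFlow_fst, coeff_zero, smul_zero, add_zero, norm_smul]
  exact mul_le_mul_of_nonneg_right (Real.abs_cos_le_one _) (norm_nonneg _)

theorem norm_freeFlow_profile_snd_le {d : ℕ} (t : ℝ) (w : H1 d) :
    ‖(freeFlow t (w, 0)).2‖ ≤ ‖w‖ := by
  rw [← one_mul ‖w‖]
  refine norm_le_of_coeff_H1_right zero_le_one fun k => ?_
  rw [coeff_freeFlow_snd, coeff_zero, smul_zero, add_zero, norm_smul, norm_neg, norm_mul, one_mul,
    Real.norm_of_nonneg (Real.sqrt_nonneg _)]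
  exact mul_le_mul_of_nonneg_right
    (mul_le_of_le_one_right (Real.sqrt_nonneg _) (Real.abs_sin_le_one _)) (norm_nonneg _)

theorem norm_freeFlow_velocity_fst_le {d : ℕ} (t : ℝ) (v : L2 d) :
    ‖(freeFlow t (0, v)).1‖ ≤ (1 + |t|) * ‖v‖ := by
  refine norm_le_of_coeff_H1_left (by positivity) fun k => ?_
  rw [coeff_freeFlow_fst, coeff_incl_zero, smul_zero, zero_add, norm_smul, mul_pow,
    Real.norm_eq_abs, sq_abs, ← mul_assoc]
  exact mul_le_mul_of_nonneg_right (one_add_eigen_mul_sinc_sq_le t k) (sq_nonneg _)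

theorem norm_freeFlow_velocity_snd_le {d : ℕ} (t : ℝ) (v : L2 d) :
    ‖(freeFlow t (0, v)).2‖ ≤ ‖v‖ := by
  rw [← one_mul ‖v‖]
  refine norm_le_of_coeff zero_le_one fun k => ?_
  rw [coeff_freeFlow_snd, coeff_incl_zero, smul_zero, zero_add, norm_smul]
  exact mul_le_mul_of_nonneg_right (Real.abs_cos_le_one _) (norm_nonneg _)

/-- The free evolution as a bounded operator. -/
def freeFlowL (d : ℕ) (t : ℝ) : (H1 d × L2 d) →L[ℝ] (H1 d × L2 d) :=
  LinearMap.mkContinuous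
    { toFun := freeFlow t
      map_add' := freeFlow_add t
      map_smul' := freeFlow_smul t } (2 + |t|) fun W => by
    change ‖freeFlow t W‖ ≤ _
    have h1 := norm_fst_le W
    have h2 := norm_snd_le W
    have h3 := abs_nonneg t
    rw [freeFlow_eq_add]
    -- The product carries the maximum norm; the profile component gives 1 + (1 + |t|).
    refine max_le ((norm_add_le _ _).trans ?_) ((norm_add_le _ _).trans ?_)
    · have := norm_freeFlow_profile_fst_le t W.1
      have := norm_freeFlow_velocity_fst_le t W.2
      nlinarith
    · have := norm_freeFlow_profile_snd_le t W.1
      have := norm_freeFlow_velocity_snd_le t W.2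
      nlinarith [norm_nonneg W]

@[simp]
theorem freeFlowL_apply {d : ℕ} (t : ℝ) (W : H1 d × L2 d) : freeFlowL d t W = freeFlow t W := rfl

theorem norm_freeFlowL_le {d : ℕ} (t : ℝ) : ‖freeFlowL d t‖ ≤ 2 + |t| :=
  LinearMap.mkContinuous_norm_le _ (by positivity) _

theorem freeFlow_zero {d : ℕ} (W : H1 d × L2 d) : freeFlow 0 W = W := by
  refine ext_coeff_prod (fun k => ?_) fun k => ?_
  · rw [coeff_freeFlow_fst, sinc_eq_mul]; simp
  · rw [coeff_freeFlow_snd]; simp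

theorem freeFlow_freeFlow {d : ℕ} (s t : ℝ) (W : H1 d × L2 d) :
    freeFlow (s + t) W = freeFlow s (freeFlow t W) := by
  have hsinc : ∀ k : Fin d → ℤ, sinc (s + t) k
      = Real.cos (√(eigen k) * s) * sinc t k + sinc s k * Real.cos (√(eigen k) * t) := by
    intro k
    by_cases hk : k = 0
    · simp [hk, sinc, eigen_zero, add_comm]
    · simp only [sinc, if_neg hk, mul_add, Real.sin_add]
      ring
  refine ext_coeff_prod (fun k => ?_) fun k => ?_
  · simp only [coeff_freeFlow_fst, coeff_freeFlow_snd, hsinc, mul_add, Real.cos_add,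
      ← sqrt_eigen_mul_sinc, Complex.real_smul]
    push_cast
    ring
  · have h1 : ((√(eigen k) * sinc t k : ℝ) : ℂ) = ((Real.sin (√(eigen k) * t) : ℝ) : ℂ) := by
      rw [sqrt_eigen_mul_sinc]
    simp only [coeff_freeFlow_fst, coeff_freeFlow_snd, mul_add, Real.cos_add, Real.sin_add,
      Complex.real_smul]
    push_cast at h1 ⊢
    linear_combination (coeff W.2 k * Complex.sin (√(eigen k) * s)) * h1

/-! ### Short-time asymptotics of the free evolution -/

theorem norm_freeFlow_profile_sub_incl_le {d : ℕ} (t : ℝ) (w : H1 d) :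
    ‖H1.incl d ((freeFlow t (w, 0)).1 - w)‖ ≤ |t| * ‖w‖ := by
  refine norm_le_of_coeff_H1_right (abs_nonneg t) fun k => ?_
  rw [map_sub, coeff_sub, coeff_freeFlow_fst, coeff_zero, smul_zero, add_zero]
  have : Real.cos (√(eigen k) * t) • coeff (H1.incl d w) k - coeff (H1.incl d w) k
      = (Real.cos (√(eigen k) * t) - 1) • coeff (H1.incl d w) k := by rw [sub_smul, one_smul]
  rw [this, norm_smul]
  refine mul_le_mul_of_nonneg_right ((abs_one_sub_cos_le _).trans ?_) (norm_nonneg _)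
  rw [abs_mul, abs_of_nonneg (Real.sqrt_nonneg _), mul_comm]

theorem norm_freeFlow_velocity_incl_le {d : ℕ} (t : ℝ) (v : L2 d) :
    ‖H1.incl d (freeFlow t (0, v)).1‖ ≤ |t| * ‖v‖ := by
  refine norm_le_of_coeff (abs_nonneg t) fun k => ?_
  rw [coeff_freeFlow_fst, coeff_incl_zero, smul_zero, zero_add, norm_smul]
  exact mul_le_mul_of_nonneg_right (abs_sinc_le t k) (norm_nonneg _)

/-- For a velocity in H¹ the profile is O(t) in H¹, whereas an L² velocity has this rate only in L².
Hence the conjugation argument is restricted to multipliers of H¹. -/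
theorem norm_freeFlow_velocity_fst_le_of_H1 {d : ℕ} (t : ℝ) (g : H1 d) :
    ‖(freeFlow t (0, H1.incl d g)).1‖ ≤ |t| * ‖g‖ := by
  refine norm_le_of_coeff_H1 (abs_nonneg t) fun k => ?_
  rw [coeff_freeFlow_fst, coeff_incl_zero, smul_zero, zero_add, norm_smul]
  exact mul_le_mul_of_nonneg_right (abs_sinc_le t k) (norm_nonneg _)

theorem norm_freeFlow_velocity_snd_sub_le {d : ℕ} (t : ℝ) (g : H1 d) :
    ‖(freeFlow t (0, H1.incl d g)).2 - H1.incl d g‖ ≤ |t| * ‖g‖ := by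
  refine norm_le_of_coeff_H1_right (abs_nonneg t) fun k => ?_
  rw [coeff_sub, coeff_freeFlow_snd, coeff_incl_zero, smul_zero, zero_add]
  have : Real.cos (√(eigen k) * t) • coeff (H1.incl d g) k - coeff (H1.incl d g) k
      = (Real.cos (√(eigen k) * t) - 1) • coeff (H1.incl d g) k := by rw [sub_smul, one_smul]
  rw [this, norm_smul]
  refine mul_le_mul_of_nonneg_right ((abs_one_sub_cos_le _).trans ?_) (norm_nonneg _)
  rw [abs_mul, abs_of_nonneg (Real.sqrt_nonneg _), mul_comm]

/-- The free evolution of `(0, v)` has profile `t v + o(t)` in `L²`. -/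
theorem tendsto_inv_smul_freeFlow_velocity {d : ℕ} (v : L2 d) :
    Tendsto (fun t : ℝ => t⁻¹ • H1.incl d (freeFlow t (0, v)).1) (𝓝[≠] 0) (𝓝 v) := by
  rw [← tendsto_sub_nhds_zero_iff]
  have hcoeff : ∀ t : ℝ, t ≠ 0 → ∀ k, coeff (t⁻¹ • H1.incl d (freeFlow t (0, v)).1 - v) k
      = (Real.sinc (√(eigen k) * t) - 1) • coeff v k := fun t ht k => by
    rw [coeff_sub, coeff_smul, coeff_freeFlow_fst, coeff_incl_zero, smul_zero, zero_add, smul_smul,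
      sinc_eq_mul, inv_mul_cancel_left₀ ht, sub_smul, one_smul]
  refine tendsto_zero_of_coeff ((hasSum_norm_coeff_sq v).summable.mul_left 4) ?_ fun k => ?_
  · filter_upwards [self_mem_nhdsWithin] with t ht k
    rw [hcoeff t ht, norm_smul, mul_pow]
    refine mul_le_mul_of_nonneg_right ?_ (sq_nonneg _)
    have := abs_le.1 (Real.abs_sinc_le_one (√(eigen k) * t))
    rw [Real.norm_eq_abs, sq_abs]
    nlinarith
  · have hc : Continuous fun t : ℝ => (Real.sinc (√(eigen k) * t) - 1) • coeff v k := by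
      have := Real.continuous_sinc
      fun_prop
    have h0 := (hc.tendsto 0).mono_left (nhdsWithin_le_nhds (s := {0}ᶜ))
    simp only [mul_zero, Real.sinc_zero, sub_self, zero_smul] at h0
    refine h0.congr' ?_
    filter_upwards [self_mem_nhdsWithin] with t ht
    exact (hcoeff t ht k).symm

/-- No rate is available in the energy norm; each piece tends to 0 by dominated convergence of its
Fourier series. -/
theorem tendsto_freeFlow_zero {d : ℕ} (W : H1 d × L2 d) :
    Tendsto (fun t : ℝ => freeFlow t W) (𝓝 0) (𝓝 W) := by
  rw [← tendsto_sub_nhds_zero_iff]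
  have h1 : Tendsto (fun t : ℝ => (freeFlow t (W.1, 0)).1 - W.1) (𝓝 0) (𝓝 0) := by
    have hcoeff : ∀ (t : ℝ) k, coeff (H1.incl d ((freeFlow t (W.1, 0)).1 - W.1)) k
        = (Real.cos (√(eigen k) * t) - 1) • coeff (H1.incl d W.1) k := fun t k => by
      rw [map_sub, coeff_sub, coeff_freeFlow_fst, coeff_zero, smul_zero, add_zero, sub_smul,
        one_smul]
    refine H1.tendsto_zero_of_coeff ((H1.hasSum_norm_sq W.1).summable.mul_left 4)
      (Eventually.of_forall fun t k => ?_) fun k => ?_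
    · rw [hcoeff, norm_smul, mul_pow, Real.norm_eq_abs, sq_abs]
      have h1 := Real.cos_le_one (√(eigen k) * t)
      have h2 := Real.neg_one_le_cos (√(eigen k) * t)
      have h3 : (Real.cos (√(eigen k) * t) - 1) ^ 2 ≤ 4 := by nlinarith
      have h4 : 0 ≤ (1 + eigen k) * ‖coeff (H1.incl d W.1) k‖ ^ 2 :=
        mul_nonneg (by linarith [eigen_nonneg k]) (sq_nonneg _)
      nlinarith
    · simp only [hcoeff]
      have hc : Continuous fun t : ℝ =>
        (Real.cos (√(eigen k) * t) - 1) • coeff (H1.incl d W.1) k := by fun_prop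
      simpa using hc.tendsto 0
  have h2 : Tendsto (fun t : ℝ => (freeFlow t (0, W.2)).1) (𝓝 0) (𝓝 0) := by
    refine H1.tendsto_zero_of_coeff
      (G := fun k => 4 * ‖coeff W.2 k‖ ^ 2) ((hasSum_norm_coeff_sq W.2).summable.mul_left 4)
      ?_ fun k => ?_
    · filter_upwards [Metric.ball_mem_nhds (0 : ℝ) one_pos] with t ht k
      rw [Metric.mem_ball, dist_zero_right, Real.norm_eq_abs] at ht
      rw [coeff_freeFlow_fst, coeff_incl_zero, smul_zero, zero_add, norm_smul, mul_pow,
        Real.norm_eq_abs, sq_abs, ← mul_assoc]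
      refine mul_le_mul_of_nonneg_right ?_ (sq_nonneg _)
      nlinarith [one_add_eigen_mul_sinc_sq_le t k, abs_nonneg t]
    · have hc : Continuous fun t : ℝ => (t * Real.sinc (√(eigen k) * t)) • coeff W.2 k := by
        have := Real.continuous_sinc
        fun_prop
      have := hc.tendsto 0
      simpa only [coeff_freeFlow_fst, coeff_incl_zero, smul_zero, zero_add, sinc_eq_mul, zero_mul,
        zero_smul] using this
  have h3 : Tendsto (fun t : ℝ => (freeFlow t W).2 - W.2) (𝓝 0) (𝓝 0) := by
    have hcoeff : ∀ (t : ℝ) k, coeff ((freeFlow t W).2 - W.2) k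
        = -(√(eigen k) * Real.sin (√(eigen k) * t)) • coeff (H1.incl d W.1) k
          + (Real.cos (√(eigen k) * t) - 1) • coeff W.2 k := fun t k => by
      rw [coeff_sub, coeff_freeFlow_snd, sub_smul, one_smul]
      ring
    refine tendsto_zero_of_coeff (((H1.hasSum_norm_sq W.1).summable.mul_left 2).add
      ((hasSum_norm_coeff_sq W.2).summable.mul_left 8))
      (Eventually.of_forall fun t k => ?_) fun k => ?_
    · rw [hcoeff]
      refine (pow_le_pow_left₀ (norm_nonneg _) (norm_add_le _ _) 2).trans ?_
      refine (add_sq_le).trans ?_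
      rw [norm_smul, norm_smul, mul_pow, mul_pow, Real.norm_eq_abs, sq_abs, Real.norm_eq_abs,
        sq_abs, neg_sq, mul_pow, Real.sq_sqrt (eigen_nonneg k)]
      have h1 := Real.cos_le_one (√(eigen k) * t)
      have h2 := Real.neg_one_le_cos (√(eigen k) * t)
      have h3 : (Real.cos (√(eigen k) * t) - 1) ^ 2 ≤ 4 := by nlinarith
      have h4 : eigen k * Real.sin (√(eigen k) * t) ^ 2 ≤ 1 + eigen k := by
        nlinarith [Real.sin_sq_le_one (√(eigen k) * t), eigen_nonneg k]
      have h5 := mul_le_mul_of_nonneg_right h4 (sq_nonneg ‖coeff (H1.incl d W.1) k‖)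
      have h6 := mul_le_mul_of_nonneg_right h3 (sq_nonneg ‖coeff W.2 k‖)
      linarith
    · simp only [hcoeff]
      have hc : Continuous fun t : ℝ =>
        -(√(eigen k) * Real.sin (√(eigen k) * t)) • coeff (H1.incl d W.1) k
          + (Real.cos (√(eigen k) * t) - 1) • coeff W.2 k := by fun_prop
      simpa using hc.tendsto 0
  have h4 := (h1.add h2).prodMk_nhds h3
  rw [add_zero] at h4
  have h5 : (fun t : ℝ => freeFlow t W - W) = fun t =>
      ((freeFlow t (W.1, 0)).1 - W.1 + (freeFlow t (0, W.2)).1, (freeFlow t W).2 - W.2) := by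
    funext t
    refine Prod.ext ?_ rfl
    rw [Prod.fst_sub, freeFlow_eq_add t W, Prod.fst_add]
    exact add_sub_right_comm _ _ _
  rw [h5]
  exact h4

theorem isStrongGroup_freeFlowL (d : ℕ) : IsStrongGroup (freeFlowL d) where
  zero := freeFlow_zero
  add s t := freeFlow_freeFlow s t
  continuous := by
    rw [continuous_iff_continuousAt]
    rintro ⟨t₀, W₀⟩
    rw [ContinuousAt, ← tendsto_sub_nhds_zero_iff]
    -- S(t)W - S(t₀)W₀ = S(t)(W - W₀) + S(t₀)(S(t - t₀)W₀ - W₀): local boundedness handles the first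
    -- term, continuity at time 0 the second.
    have h1 : Tendsto (fun q : ℝ × (H1 d × L2 d) => freeFlowL d q.1 (q.2 - W₀)) (𝓝 (t₀, W₀))
        (𝓝 0) := by
      refine squeeze_zero_norm (a := fun q => (2 + |q.1|) * ‖q.2 - W₀‖) (fun q =>
        ContinuousLinearMap.le_of_opNorm_le _ (norm_freeFlowL_le q.1) _) ?_
      have hc : Continuous fun q : ℝ × (H1 d × L2 d) => (2 + |q.1|) * ‖q.2 - W₀‖ := by fun_prop
      simpa using hc.tendsto (t₀, W₀)
    have h2 : Tendsto (fun q : ℝ × (H1 d × L2 d) =>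
        freeFlowL d t₀ (freeFlow (q.1 - t₀) W₀ - W₀)) (𝓝 (t₀, W₀)) (𝓝 0) := by
      have hs : Tendsto (fun q : ℝ × (H1 d × L2 d) => q.1 - t₀) (𝓝 (t₀, W₀)) (𝓝 0) := by
        have hc : Continuous fun q : ℝ × (H1 d × L2 d) => q.1 - t₀ := by fun_prop
        simpa using hc.tendsto (t₀, W₀)
      have h3 := ((tendsto_freeFlow_zero W₀).comp hs).sub_const W₀
      rw [sub_self] at h3
      have h4 := ((freeFlowL d t₀).continuous.tendsto 0).comp h3
      rwa [map_zero] at h4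
    have h3 := h1.add h2
    rw [add_zero] at h3
    refine h3.congr fun q => ?_
    rw [map_sub, map_sub]
    simp only [freeFlowL_apply]
    rw [← freeFlow_freeFlow, add_sub_cancel]
    exact sub_add_sub_cancel _ _ _

/-! ### Piecewise constant controls and approximate reachability -/

/-- For N = 0 the subdivision is the single point 0, and no interval remains to be checked. -/
theorem isPiecewiseConstant_zero {E : Type*} (p : ℝ → E) : IsPiecewiseConstant 0 p :=
  ⟨0, fun _ => 0, fun i j h => absurd h (by rw [Subsingleton.elim (α := Fin 1) i j]; exact lt_irrefl _), rfl, rfl, fun i => i.elim0⟩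

theorem IsPiecewiseConstant.append_const {E : Type*} {τ δ : ℝ} {p : ℝ → E}
    (hp : IsPiecewiseConstant τ p) (hδ : 0 < δ) (c : E) :
    IsPiecewiseConstant (τ + δ) (fun s => if s ≤ τ then p s else c) := by
  obtain ⟨N, t, ht, h0, hN, hc⟩ := hp
  refine ⟨N + 1, Fin.snoc (α := fun _ => ℝ) t (τ + δ), ?_, ?_, Fin.snoc_last _ _, fun i => ?_⟩
  · rw [Fin.strictMono_iff_lt_succ]
    intro i
    refine Fin.lastCases ?_ (fun i => ?_) i
    · rw [Fin.succ_last, Fin.snoc_last, Fin.snoc_castSucc, hN]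
      linarith
    · rw [Fin.succ_castSucc, Fin.snoc_castSucc, Fin.snoc_castSucc]
      exact ht (Fin.castSucc_lt_succ)
  · rw [← Fin.castSucc_zero, Fin.snoc_castSucc, h0]
  · refine Fin.lastCases ?_ (fun i => ?_) i
    · refine ⟨c, fun s hs => ?_⟩
      rw [Fin.snoc_castSucc, hN] at hs
      simp only [if_neg (not_le.2 hs.1)]
    · obtain ⟨e, he⟩ := hc i
      refine ⟨e, fun s hs => ?_⟩
      rw [Fin.succ_castSucc, Fin.snoc_castSucc, Fin.snoc_castSucc] at hs
      have hle : s ≤ τ := hs.2.le.trans (hN ▸ ht.monotone (Fin.le_last _))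
      simp only [if_pos hle]
      exact he s hs

section Reach

variable {X P : Type*} [NormedAddCommGroup X] [NormedSpace ℝ X] [AddCommGroup P] [Module ℝ P]

/-- `Flow S B τ L`: some piecewise constant control steers every state `W` to `L W` in time `τ`,
and `L` is continuous. -/
inductive Flow (S : ℝ → X →L[ℝ] X) (B : P →ₗ[ℝ] (X →L[ℝ] X)) : ℝ → (X → X) → Prop
  | refl : Flow S B 0 id
  | step {τ δ : ℝ} {L L' : X → X} (c : P) : Flow S B τ L → 0 < δ → Continuous L' →
      (∀ W₀, ∃ W, IsMild S δ (fun _ => B c) W₀ W ∧ W δ = L' W₀) → Flow S B (τ + δ) (L' ∘ L)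

variable {S : ℝ → X →L[ℝ] X} {B : P →ₗ[ℝ] (X →L[ℝ] X)}

theorem Flow.nonneg {τ : ℝ} {L : X → X} (h : Flow S B τ L) : 0 ≤ τ := by
  induction h with
  | refl => exact le_rfl
  | step c _ hδ _ _ ih => linarith

theorem Flow.continuous {τ : ℝ} {L : X → X} (h : Flow S B τ L) : Continuous L := by
  induction h with
  | refl => exact continuous_id
  | step c _ _ hL _ ih => exact hL.comp ih

theorem Flow.comp {τ τ' : ℝ} {L L' : X → X} (h : Flow S B τ L) (h' : Flow S B τ' L') :
    Flow S B (τ + τ') (L' ∘ L) := by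
  induction h' with
  | refl => rwa [add_zero]
  | step c _ hδ hL' hW ih =>
    rw [← add_assoc]
    exact Flow.step (L := _ ∘ L) c ih hδ hL' hW

/-- One control serves all initial states. The bound on the control operators is recorded because
uniqueness of solutions requires it. -/
theorem Flow.exists_control [CompleteSpace X] (hS : IsStrongGroup S) {τ : ℝ} {L : X → X}
    (h : Flow S B τ L) : ∃ p : ℝ → P, IsPiecewiseConstant τ p ∧ (∃ C, ∀ s, ‖B (p s)‖ ≤ C) ∧
      ∀ W₀, ∃ W, IsMild S τ (fun s => B (p s)) W₀ W ∧ W τ = L W₀ := by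
  induction h with
  | refl =>
    refine ⟨fun _ => 0, isPiecewiseConstant_zero _, ⟨_, fun _ => le_rfl⟩, fun W₀ =>
      ⟨fun _ => W₀, ⟨continuousOn_const, fun t _ => by simp, fun t ht => ?_⟩, rfl⟩⟩
    obtain rfl : t = 0 := by simpa using ht
    simp [hS.zero]
  | @step τ δ L L' c hτ hδ hL hW ih =>
    obtain ⟨p, hp, ⟨C, hC⟩, hsol⟩ := ih
    refine ⟨_, hp.append_const hδ c, ⟨max C ‖B c‖, fun s => ?_⟩, fun W₀ => ?_⟩
    · split_ifs
      · exact (hC s).trans (le_max_left _ _)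
      · exact le_max_right _ _
    · obtain ⟨W₁, hW₁, hL₁⟩ := hsol W₀
      obtain ⟨W₂, hW₂, hL₂⟩ := hW (L W₀)
      rw [← hL₁] at hW₂
      refine ⟨fun s => if s ≤ τ then W₁ s else W₂ (s - τ), ?_, ?_⟩
      · have h := hW₁.append hS hτ.nonneg hW₂ hδ.le
        simp only [← apply_ite B] at h
        exact h
      · simp [not_le.2 hδ, hL₂]

/-- Approximate reachability within time `T`. -/
def ReachIn (S : ℝ → X →L[ℝ] X) (B : P →ₗ[ℝ] (X →L[ℝ] X)) (T : ℝ) (W W' : X) : Prop :=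
  ∀ ε > 0, ∃ τ ≤ T, ∃ L, Flow S B τ L ∧ ‖L W - W'‖ < ε

/-- The second leg is chosen before the first: continuity of its flow at W' dictates how closely the
first leg must approach W'. -/
theorem ReachIn.trans {T T' : ℝ} {W W' W'' : X} (h : ReachIn S B T W W')
    (h' : ReachIn S B T' W' W'') : ReachIn S B (T + T') W W'' := by
  intro ε hε
  obtain ⟨τ', hτ', L', hL', hW'⟩ := h' (ε / 2) (half_pos hε)
  obtain ⟨r, hr, hcont⟩ := Metric.continuousAt_iff.1 (hL'.continuous.continuousAt (x := W'))
    (ε / 2) (half_pos hε)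
  obtain ⟨τ, hτ, L, hL, hW⟩ := h r hr
  refine ⟨τ + τ', add_le_add hτ hτ', L' ∘ L, hL.comp hL', ?_⟩
  have h1 := hcont (x := L W) (by rwa [dist_eq_norm])
  rw [dist_eq_norm] at h1
  have h2 := norm_sub_le_norm_sub_add_norm_sub (L' (L W)) (L' W') W''
  simp only [Function.comp_apply]
  linarith

theorem ReachIn.of_approx {T : ℝ} {W W' : X}
    (h : ∀ ε > 0, ∃ W'', ReachIn S B T W W'' ∧ ‖W'' - W'‖ < ε) : ReachIn S B T W W' := by
  intro ε hε
  obtain ⟨W'', h1, h2⟩ := h (ε / 2) (half_pos hε)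
  obtain ⟨τ, hτ, L, hL, h3⟩ := h1 (ε / 2) (half_pos hε)
  refine ⟨τ, hτ, L, hL, ?_⟩
  have := norm_sub_le_norm_sub_add_norm_sub (L W) W'' W'
  linarith

theorem ReachIn.mono {T T' : ℝ} {W W' : X} (h : ReachIn S B T W W') (hT : T ≤ T') :
    ReachIn S B T' W W' := by
  intro ε hε
  obtain ⟨τ, hτ, L, hL, h3⟩ := h ε hε
  exact ⟨τ, hτ.trans hT, L, hL, h3⟩

theorem ReachIn.free (hS : IsStrongGroup S) {t : ℝ} (ht : 0 < t) (W : X) :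
    ReachIn S B t W (S t W) := by
  intro ε hε
  refine ⟨t, le_rfl, S t, ?_, by simpa using hε⟩
  have h := Flow.step (S := S) (B := B) (0 : P) Flow.refl ht (S t).continuous fun W₀ =>
    ⟨fun s => S s W₀, ⟨(hS.continuous.comp
      (continuous_id.prodMk continuous_const)).continuousOn, fun s _ => by simp,
      fun s _ => by simp⟩, rfl⟩
  simpa using h

/-- Every state `W` can be steered approximately to `W + K W` in arbitrarily small time. -/
def Impulse (S : ℝ → X →L[ℝ] X) (B : P →ₗ[ℝ] (X →L[ℝ] X)) (K : X →L[ℝ] X) : Prop :=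
  ∀ T > 0, ∀ W, ReachIn S B T W (W + K W)

/-- (1 + K')(1 + K) = 1 + K + K' because K' K = 0. -/
theorem Impulse.add {K K' : X →L[ℝ] X} (h : Impulse S B K) (h' : Impulse S B K')
    (hK : ∀ x, K' (K x) = 0) : Impulse S B (K + K') := by
  intro T hT W
  have := (h (T / 2) (half_pos hT) W).trans (h' (T / 2) (half_pos hT) (W + K W))
  rw [add_halves, map_add, hK, add_zero, add_assoc] at this
  exact this

theorem Impulse.of_small [CompleteSpace X] (hS : IsStrongGroup S) {M : ℝ}
    (hM : ∀ t ∈ Icc 0 1, ‖S t‖ ≤ M) (c : P) (hc : M * ‖B c‖ ≤ 1 / 2)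
    (hBB : ∀ x, B c (B c x) = 0) : Impulse S B (B c) := by
  intro T hT W ε hε
  have hcont : ∀ x, Tendsto (fun t => S t x - x) (𝓝 0) (𝓝 0) := fun x => by
    have h1 : Continuous fun t => S t x - x :=
      (hS.continuous.comp (continuous_id.prodMk continuous_const)).sub continuous_const
    simpa [hS.zero] using h1.tendsto 0
  -- The impulse estimate costs 4η, so η = ε/5 leaves a strict inequality.
  have hev : ∀ x, ∃ r > 0, ∀ t, |t| < r → ‖S t x - x‖ ≤ ε / 5 := fun x => by
    obtain ⟨r, hr, h⟩ := Metric.tendsto_nhds_nhds.1 (hcont x) (ε / 5) (by positivity)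
    refine ⟨r, hr, fun t ht => ?_⟩
    have := h (x := t) (by rwa [Real.dist_eq, sub_zero])
    rw [dist_zero_right] at this
    exact this.le
  obtain ⟨r₁, hr₁, h₁⟩ := hev W
  obtain ⟨r₂, hr₂, h₂⟩ := hev (B c W)
  obtain ⟨δ, hδ, hδmin⟩ := exists_between (lt_min (lt_min hr₁ hr₂) (lt_min hT one_pos))
  rw [lt_min_iff, lt_min_iff, lt_min_iff] at hδmin
  obtain ⟨⟨hδ1, hδ2⟩, hδT, hδ3⟩ := hδmin
  have hMδ : ∀ t ∈ Icc 0 δ, ‖S t‖ ≤ M := fun t ht => hM t ⟨ht.1, ht.2.trans hδ3.le⟩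
  have hM0 : 0 ≤ M := (norm_nonneg _).trans (hM 0 ⟨le_rfl, zero_le_one⟩)
  -- Duration and amplitude cancel, so the smallness condition does not depend on δ.
  have hsmall : δ * (M * ‖δ⁻¹ • B c‖) ≤ 1 / 2 := by
    rw [norm_smul, norm_inv, Real.norm_of_nonneg hδ.le]
    refine le_trans (le_of_eq ?_) hc
    field_simp
  choose sol hsol using fun W₀ => hS.exists_isMild hδ.le hMδ (δ⁻¹ • B c) hsmall W₀
  have hlip : Continuous fun W₀ => sol W₀ δ := by
    refine (LipschitzWith.of_dist_le_mul (K := (2 * M).toNNReal) fun W₀ W₀' => ?_).continuous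
    rw [dist_eq_norm, dist_eq_norm, Real.coe_toNNReal _ (by positivity), mul_assoc]
    exact (hsol W₀).norm_sub_le hMδ hsmall (hsol W₀') δ ⟨hδ.le, le_rfl⟩
  have hflow := Flow.step (S := S) (B := B) (δ⁻¹ • c) Flow.refl hδ hlip fun W₀ =>
    ⟨sol W₀, by rw [map_smul]; exact hsol W₀, rfl⟩
  refine ⟨0 + δ, by linarith, _, hflow, ?_⟩
  have := (hsol W).norm_sub_impulse_le hδ hMδ hc hBB
    (fun t ht => h₁ t (by rw [abs_of_nonneg ht.1]; exact ht.2.trans_lt hδ1))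
    (fun t ht => h₂ t (by rw [abs_of_nonneg ht.1]; exact ht.2.trans_lt hδ2))
  simp only [Function.comp_apply, id]
  linarith

/-- A large kick is a succession of n + 1 equal small ones. -/
theorem Impulse.of_control [CompleteSpace X] (hS : IsStrongGroup S)
    (hBB : ∀ c c' x, B c (B c' x) = 0) (c : P) : Impulse S B (B c) := by
  obtain ⟨M, hM0, hM⟩ := hS.exists_bound 1
  obtain ⟨n, hn⟩ := exists_nat_ge (2 * (M * ‖B c‖))
  set e : P := ((n + 1 : ℕ) : ℝ)⁻¹ • c with he
  have hpos : (0 : ℝ) < ((n + 1 : ℕ) : ℝ) := by positivity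
  have hsmall : M * ‖B e‖ ≤ 1 / 2 := by
    rw [he, map_smul, norm_smul, norm_inv, Real.norm_of_nonneg hpos.le]
    rw [mul_left_comm, inv_mul_le_iff₀ hpos]
    push_cast
    linarith
  have h1 : Impulse S B (B e) := Impulse.of_small hS hM e hsmall (hBB e e)
  have h2 : ∀ m : ℕ, Impulse S B (B (((m + 1 : ℕ) : ℝ) • e)) := by
    intro m
    induction m with
    | zero => simpa using h1
    | succ m ih =>
      have h3 := ih.add h1 fun x => hBB _ _ _
      rw [← map_add] at h3
      have e1 : ((m + 1 : ℕ) : ℝ) • e + e = ((m + 1 + 1 : ℕ) : ℝ) • e := by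
        push_cast
        module
      rwa [e1] at h3
  have h3 := h2 n
  rwa [he, smul_smul, mul_inv_cancel₀ hpos.ne', one_smul] at h3

end Reach

/-! ### Multiplication operators and the control operator -/

theorem coeFn_mulL2 {d : ℕ} (m : C(Torus d, ℝ)) (w : L2 d) :
    mulL2 m w =ᵐ[volume] fun x => m x * w x := MemLp.coeFn_toLp _

theorem mulL2_add_left {d : ℕ} (m n : C(Torus d, ℝ)) (w : L2 d) :
    mulL2 (m + n) w = mulL2 m w + mulL2 n w := by
  refine Lp.ext ?_
  filter_upwards [coeFn_mulL2 (m + n) w, coeFn_mulL2 m w, coeFn_mulL2 n w,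
    Lp.coeFn_add (mulL2 m w) (mulL2 n w)] with x h1 h2 h3 h4
  rw [h4, h1, Pi.add_apply, h2, h3, ContinuousMap.add_apply, add_mul]

theorem mulL2_smul_left {d : ℕ} (c : ℝ) (m : C(Torus d, ℝ)) (w : L2 d) :
    mulL2 (c • m) w = c • mulL2 m w := by
  refine Lp.ext ?_
  filter_upwards [coeFn_mulL2 (c • m) w, coeFn_mulL2 m w, Lp.coeFn_smul c (mulL2 m w)]
    with x h1 h2 h3
  rw [h3, h1, Pi.smul_apply, h2, ContinuousMap.smul_apply, smul_mul_assoc]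

theorem mulL2_add_right {d : ℕ} (m : C(Torus d, ℝ)) (v w : L2 d) :
    mulL2 m (v + w) = mulL2 m v + mulL2 m w := by
  refine Lp.ext ?_
  filter_upwards [coeFn_mulL2 m (v + w), coeFn_mulL2 m v, coeFn_mulL2 m w, Lp.coeFn_add v w,
    Lp.coeFn_add (mulL2 m v) (mulL2 m w)] with x h1 h2 h3 h4 h5
  rw [h5, h1, h4, Pi.add_apply, Pi.add_apply, h2, h3, mul_add]

theorem mulL2_smul_right {d : ℕ} (c : ℝ) (m : C(Torus d, ℝ)) (w : L2 d) :
    mulL2 m (c • w) = c • mulL2 m w := by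
  refine Lp.ext ?_
  filter_upwards [coeFn_mulL2 m (c • w), coeFn_mulL2 m w, Lp.coeFn_smul c w,
    Lp.coeFn_smul c (mulL2 m w)] with x h1 h2 h3 h4
  rw [h4, h1, h3, Pi.smul_apply, Pi.smul_apply, h2, mul_smul_comm]

theorem mulL2_mul {d : ℕ} (m n : C(Torus d, ℝ)) (w : L2 d) :
    mulL2 (m * n) w = mulL2 m (mulL2 n w) := by
  refine Lp.ext ?_
  filter_upwards [coeFn_mulL2 (m * n) w, coeFn_mulL2 m (mulL2 n w), coeFn_mulL2 n w]
    with x h1 h2 h3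
  rw [h1, h2, h3, ContinuousMap.mul_apply, mul_assoc]

theorem norm_mulL2_le {d : ℕ} (m : C(Torus d, ℝ)) (w : L2 d) : ‖mulL2 m w‖ ≤ ‖m‖ * ‖w‖ := by
  refine Lp.norm_le_mul_norm_of_ae_le_mul ?_
  filter_upwards [coeFn_mulL2 m w] with x hx
  rw [hx, norm_mul]
  exact mul_le_mul_of_nonneg_right (m.norm_coe_le_norm x) (norm_nonneg _)

/-- Multiplication by a continuous function, as a bounded operator. -/
def mulL {d : ℕ} (m : C(Torus d, ℝ)) : L2 d →L[ℝ] L2 d :=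
  LinearMap.mkContinuous
    { toFun := mulL2 m
      map_add' := mulL2_add_right m
      map_smul' := fun c w => mulL2_smul_right c m w } ‖m‖ (norm_mulL2_le m)

@[simp]
theorem mulL_apply {d : ℕ} (m : C(Torus d, ℝ)) (w : L2 d) : mulL m w = mulL2 m w := rfl

/-- The inclusion `H¹ → L²` as a bounded operator. -/
def inclL (d : ℕ) : H1 d →L[ℝ] L2 d :=
  LinearMap.mkContinuous (H1.incl d) 1 fun w => by
    rw [one_mul]; exact H1.norm_incl_le w

/-- The operator `m B`, `B (w, v) = (0, w)`, depending linearly on `m`. -/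
def kick (d : ℕ) : C(Torus d, ℝ) →ₗ[ℝ] ((H1 d × L2 d) →L[ℝ] (H1 d × L2 d)) where
  toFun m := (ContinuousLinearMap.inr ℝ (H1 d) (L2 d)).comp
    ((mulL m).comp ((inclL d).comp (ContinuousLinearMap.fst ℝ (H1 d) (L2 d))))
  map_add' m n := by
    refine ContinuousLinearMap.ext fun W => Prod.ext ?_ ?_
    · exact (add_zero (0 : H1 d)).symm
    · exact mulL2_add_left m n _
  map_smul' c m := by
    refine ContinuousLinearMap.ext fun W => Prod.ext ?_ ?_
    · exact (smul_zero c (A := H1 d)).symm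
    · exact mulL2_smul_left c m _

theorem kick_apply {d : ℕ} (m : C(Torus d, ℝ)) (W : H1 d × L2 d) :
    kick d m W = (0, mulL2 m (H1.incl d W.1)) := rfl

theorem kick_kick {d : ℕ} (m n : C(Torus d, ℝ)) (W : H1 d × L2 d) :
    kick d m (kick d n W) = 0 := by
  rw [kick_apply, kick_apply, map_zero, ← mulL_apply, map_zero]
  rfl

/-- The potential as a linear function of the control value. -/
def potentialL (d : ℕ) : (Fin (2 * d + 1) → ℝ) →ₗ[ℝ] C(Torus d, ℝ) where
  toFun := potential
  map_add' p q := by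
    simp only [potential, Pi.add_apply, add_smul, Finset.sum_add_distrib]
  map_smul' c p := by
    simp only [potential, Pi.smul_apply, smul_assoc, Finset.smul_sum, RingHom.id_apply]

/-- The control operator as a linear function of the control value. -/
def controlL (d : ℕ) :
    (Fin (2 * d + 1) → ℝ) →ₗ[ℝ] ((H1 d × L2 d) →L[ℝ] (H1 d × L2 d)) :=
  (kick d).comp (potentialL d)

theorem isMild_iff_isWeakSolution {d : ℕ} {τ : ℝ} {p : ℝ → Fin (2 * d + 1) → ℝ}
    {W₀ : H1 d × L2 d} {W : ℝ → H1 d × L2 d} :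
    IsMild (freeFlowL d) τ (fun s => controlL d (p s)) W₀ W ↔ IsWeakSolution τ p W₀ W :=
  ⟨fun h => ⟨h.1, h.2, h.3⟩, fun h => ⟨h.1, h.2, h.3⟩⟩

/-! ### Saturation -/

/-- The velocity can be changed by `m w` in arbitrarily small time. -/
def Kickable {d : ℕ} (m : C(Torus d, ℝ)) : Prop :=
  Impulse (freeFlowL d) (controlL d) (kick d m)

theorem Kickable.add {d : ℕ} {m n : C(Torus d, ℝ)} (hm : Kickable m) (hn : Kickable n) :
    Kickable (m + n) := by
  rw [Kickable, map_add]
  exact Impulse.add hm hn (kick_kick n m)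

theorem kickable_potential {d : ℕ} (p : Fin (2 * d + 1) → ℝ) : Kickable (potential p) :=
  Impulse.of_control (B := controlL d) (isStrongGroup_freeFlowL d)
    (fun c c' => kick_kick (potential c) (potential c')) p

/-- The functions all of whose real multiples are kickable. -/
def kickSpace (d : ℕ) : Submodule ℝ C(Torus d, ℝ) where
  carrier := {m | ∀ c : ℝ, Kickable (c • m)}
  add_mem' hm hn c := by
    rw [smul_add]
    exact (hm c).add (hn c)
  zero_mem' c := by
    have h := kickable_potential (0 : Fin (2 * d + 1) → ℝ)
    simpa [potential] using h
  smul_mem' a m hm c := by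
    rw [smul_smul]
    exact hm _

theorem lowMode_mem_kickSpace {d : ℕ} (j : Fin (2 * d + 1)) : lowMode d j ∈ kickSpace d := by
  intro c
  have h := kickable_potential (Pi.single j c : Fin (2 * d + 1) → ℝ)
  have e : potential (Pi.single j c) = c • lowMode d j := by
    rw [potential, Finset.sum_eq_single j]
    · rw [Pi.single_eq_same]
    · intro i _ hi
      rw [Pi.single_eq_of_ne hi, zero_smul]
    · simp
  rwa [e] at h

/-- The continuous functions that are multipliers of `H¹`. -/
def H1Multiplier (d : ℕ) : Submodule ℝ C(Torus d, ℝ) where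
  carrier := {m | ∀ w : H1 d, ∃ g : H1 d, H1.incl d g = mulL2 m (H1.incl d w)}
  add_mem' hm hn w := by
    obtain ⟨g, hg⟩ := hm w
    obtain ⟨g', hg'⟩ := hn w
    exact ⟨g + g', by rw [map_add, hg, hg', mulL2_add_left]⟩
  zero_mem' w := ⟨0, by
    have := mulL2_smul_left 0 (0 : C(Torus d, ℝ)) (H1.incl d w)
    rw [map_zero]
    rwa [zero_smul, zero_smul, eq_comm] at this⟩
  smul_mem' c m hm w := by
    obtain ⟨g, hg⟩ := hm w
    exact ⟨c • g, by rw [map_smul, hg, mulL2_smul_left]⟩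

theorem tendsto_inv_smul_of_norm_le {E : Type*} [NormedAddCommGroup E] [NormedSpace ℝ E]
    {f : ℝ → E} {C : ℝ} (h : ∀ r, ‖f r‖ ≤ |r ^ 2| * C) :
    Tendsto (fun r : ℝ => r⁻¹ • f r) (𝓝[>] 0) (𝓝 0) := by
  have h0 : Tendsto (fun r : ℝ => r * C) (𝓝[>] 0) (𝓝 0) := by
    have hc : Continuous fun r : ℝ => r * C := by fun_prop
    have := hc.tendsto 0
    rw [zero_mul] at this
    exact this.mono_left nhdsWithin_le_nhds
  refine squeeze_zero_norm' ?_ h0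
  filter_upwards [self_mem_nhdsWithin] with r hr
  have hr : 0 < r := hr
  rw [norm_smul, norm_inv, Real.norm_of_nonneg hr.le, inv_mul_le_iff₀ hr]
  refine (h r).trans (le_of_eq ?_)
  rw [abs_of_nonneg (sq_nonneg r)]
  ring

/-- Conjugating the free evolution during the time `r²` by the kicks `± r⁻¹ m` gives the kick
`-m²` as `r → 0`. -/
theorem tendsto_conj_kick {d : ℕ} {m : C(Torus d, ℝ)} (W : H1 d × L2 d) {g : H1 d}
    (hg : H1.incl d g = mulL2 m (H1.incl d W.1)) :
    Tendsto (fun r : ℝ => freeFlow (r ^ 2) (W + kick d (r⁻¹ • m) W)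
      + kick d (-r⁻¹ • m) (freeFlow (r ^ 2) (W + kick d (r⁻¹ • m) W))) (𝓝[>] 0)
      (𝓝 (W + kick d (-(m * m)) W)) := by
  have hsq : Tendsto (fun r : ℝ => r ^ 2) (𝓝[>] 0) (𝓝 0) := by
    have hc : Continuous fun r : ℝ => r ^ 2 := by fun_prop
    have := hc.tendsto 0
    rw [zero_pow two_ne_zero] at this
    exact this.mono_left nhdsWithin_le_nhds
  have hsq' : Tendsto (fun r : ℝ => r ^ 2) (𝓝[>] 0) (𝓝[≠] 0) := by
    refine tendsto_nhdsWithin_iff.2 ⟨hsq, ?_⟩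
    filter_upwards [self_mem_nhdsWithin] with r hr
    exact pow_ne_zero 2 (ne_of_gt hr)
  have ha := (tendsto_freeFlow_zero W).comp hsq
  -- The kick has size 1/r and the flow lasts r², so errors of order r² survive division by r.
  have hb : Tendsto (fun r : ℝ => r⁻¹ • (freeFlow (r ^ 2) (0, H1.incl d g)).1) (𝓝[>] 0) (𝓝 0) :=
    tendsto_inv_smul_of_norm_le fun r => norm_freeFlow_velocity_fst_le_of_H1 (r ^ 2) g
  have hc : Tendsto (fun r : ℝ => r⁻¹ • ((freeFlow (r ^ 2) (0, H1.incl d g)).2 - H1.incl d g))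
      (𝓝[>] 0) (𝓝 0) :=
    tendsto_inv_smul_of_norm_le fun r => norm_freeFlow_velocity_snd_sub_le (r ^ 2) g
  have hd : Tendsto (fun r : ℝ => r⁻¹ • H1.incl d ((freeFlow (r ^ 2) W).1 - W.1))
      (𝓝[>] 0) (𝓝 0) := by
    refine tendsto_inv_smul_of_norm_le (C := ‖W.1‖ + ‖W.2‖) fun r => ?_
    have e : (freeFlow (r ^ 2) W).1 - W.1
        = ((freeFlow (r ^ 2) (W.1, 0)).1 - W.1) + (freeFlow (r ^ 2) (0, W.2)).1 := by
      rw [freeFlow_eq_add, Prod.fst_add]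
      exact add_sub_right_comm _ _ _
    rw [e, map_add, mul_add]
    exact (norm_add_le _ _).trans (add_le_add (norm_freeFlow_profile_sub_incl_le _ _)
      (norm_freeFlow_velocity_incl_le _ _))
  have he := (tendsto_inv_smul_freeFlow_velocity (H1.incl d g)).comp hsq'
  have hmd := ((mulL m).continuous.tendsto 0).comp hd
  -- The only surviving contribution: the profile generated by the velocity g = m w is r² g to
  -- leading order, and multiplying it by m / r² gives m² w.
  have hme := ((mulL m).continuous.tendsto (H1.incl d g)).comp he
  rw [map_zero] at hmd
  rw [mulL_apply m (H1.incl d g), hg, ← mulL2_mul, ← hg] at hme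
  have h1 := ((continuous_fst.tendsto W).comp ha).add hb
  have h2 := ((((continuous_snd.tendsto W).comp ha).add hc).sub hmd).sub hme
  rw [add_zero] at h1
  rw [add_zero, sub_zero] at h2
  have htarget : W + kick d (-(m * m)) W = (W.1, W.2 - mulL2 (m * m) (H1.incl d W.1)) := by
    rw [map_neg, sub_eq_add_neg]
    refine Prod.ext ?_ rfl
    change W.1 + -0 = W.1
    rw [neg_zero, add_zero]
  rw [htarget]
  refine (h1.prodMk_nhds h2).congr' ?_
  filter_upwards [self_mem_nhdsWithin] with r hr
  have hr : r ≠ 0 := ne_of_gt hr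
  have hkick : W + kick d (r⁻¹ • m) W = W + r⁻¹ • ((0, H1.incl d g) : H1 d × L2 d) := by
    rw [map_smul, FunLike.coe_smul, Pi.smul_apply, kick_apply, hg]
  have hflow : freeFlow (r ^ 2) (W + kick d (r⁻¹ • m) W)
      = freeFlow (r ^ 2) W + r⁻¹ • freeFlow (r ^ 2) (0, H1.incl d g) := by
    rw [hkick, freeFlow_add, freeFlow_smul]
  simp only [Function.comp_apply]
  rw [hflow]
  generalize freeFlow (r ^ 2) W = A
  generalize freeFlow (r ^ 2) (0, H1.incl d g) = G
  rw [kick_apply]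
  refine Prod.ext ?_ ?_
  · simp only [Prod.fst_add, Prod.smul_fst, add_zero]
  · simp only [Prod.snd_add, Prod.smul_snd, Prod.fst_add, Prod.smul_fst]
    rw [mulL2_smul_left, ← mulL_apply]
    simp only [map_add, map_smul, map_sub]
    rw [mulL_apply m (H1.incl d W.1), ← hg]
    -- One factor r⁻¹ comes from each kick; together they match the division by the flow time.
    have hr2 : (r ^ 2)⁻¹ = r⁻¹ * r⁻¹ := by rw [pow_two, mul_inv]
    rw [hr2]
    module

theorem kickable_neg_mul_self {d : ℕ} {m : C(Torus d, ℝ)} (hm : m ∈ kickSpace d)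
    (hM : m ∈ H1Multiplier d) : Kickable (-(m * m)) := by
  intro T hT W
  refine ReachIn.of_approx fun ε hε => ?_
  obtain ⟨g, hg⟩ := hM W.1
  have hlim := tendsto_conj_kick W hg
  have h1 := Metric.tendsto_nhds.1 hlim ε hε
  have h2 : ∀ᶠ r : ℝ in 𝓝[>] 0, r ^ 2 < T / 3 := by
    have hc : Continuous fun r : ℝ => r ^ 2 := by fun_prop
    exact (hc.tendsto 0).mono_left nhdsWithin_le_nhds |>.eventually
      (gt_mem_nhds (by simpa using hT))
  obtain ⟨r, ⟨h1, h2⟩, hr⟩ := ((h1.and h2).and self_mem_nhdsWithin).exists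
  have hr : 0 < r := hr
  rw [dist_eq_norm] at h1
  refine ⟨_, ?_, h1⟩
  have p1 := hm r⁻¹ (T / 3) (by positivity) W
  have p2 := ReachIn.free (B := controlL d) (isStrongGroup_freeFlowL d) (t := r ^ 2)
    (by positivity) (W + kick d (r⁻¹ • m) W)
  have p3 := hm (-r⁻¹) (T / 3) (by positivity) (freeFlow (r ^ 2) (W + kick d (r⁻¹ • m) W))
  exact ((p1.trans p2).trans p3).mono (by linarith)

/-- Conjugation with √c m in place of m; only nonpositive multiples of squares arise this way. -/
theorem kickable_neg_smul_mul_self {d : ℕ} {m : C(Torus d, ℝ)} (hm : m ∈ kickSpace d)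
    (hM : m ∈ H1Multiplier d) {c : ℝ} (hc : 0 ≤ c) : Kickable (-(c • (m * m))) := by
  have h := kickable_neg_mul_self ((kickSpace d).smul_mem (√c) hm)
    ((H1Multiplier d).smul_mem (√c) hM)
  rwa [smul_mul_smul_comm, Real.mul_self_sqrt hc] at h

theorem one_mem_kickSpace (d : ℕ) : (1 : C(Torus d, ℝ)) ∈ kickSpace d :=
  lowMode_mem_kickSpace (0 : Fin (2 * d + 1))

/-- The missing sign comes from the constant function: for c ≥ 0, c a² = c · 1 - c b². -/
theorem mul_self_mem_kickSpace {d : ℕ} {a b : C(Torus d, ℝ)} (ha : a ∈ kickSpace d)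
    (hb : b ∈ kickSpace d) (hMa : a ∈ H1Multiplier d) (hMb : b ∈ H1Multiplier d)
    (hab : a * a + b * b = 1) : a * a ∈ kickSpace d := by
  intro c
  rcases le_total 0 c with hc | hc
  · have h := (one_mem_kickSpace d c).add (kickable_neg_smul_mul_self hb hMb hc)
    rwa [← hab, smul_add, add_neg_cancel_right] at h
  · have h := kickable_neg_smul_mul_self ha hMa (neg_nonneg.2 hc)
    rwa [neg_smul, neg_neg] at h

/-- Polarization, with (a - b)² for c ≥ 0 and (a + b)² for c ≤ 0, so that the mixed square always
enters with a nonpositive coefficient. The pure squares are available with both signs. -/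
theorem mul_mem_kickSpace {d : ℕ} {a b : C(Torus d, ℝ)} (ha : a ∈ kickSpace d)
    (hb : b ∈ kickSpace d) (hMa : a ∈ H1Multiplier d) (hMb : b ∈ H1Multiplier d)
    (haa : a * a ∈ kickSpace d) (hbb : b * b ∈ kickSpace d) : a * b ∈ kickSpace d := by
  intro c
  rcases le_total 0 c with hc | hc
  · have h := ((kickable_neg_smul_mul_self ((kickSpace d).sub_mem ha hb)
      ((H1Multiplier d).sub_mem hMa hMb) (c := c / 2) (by linarith)).add (haa (c / 2))).add (hbb (c / 2))
    have e : -((c / 2) • ((a - b) * (a - b))) + (c / 2) • (a * a) + (c / 2) • (b * b)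
        = c • (a * b) := by
      ext x
      simp
      ring
    rwa [e] at h
  · have h := ((kickable_neg_smul_mul_self ((kickSpace d).add_mem ha hb)
      ((H1Multiplier d).add_mem hMa hMb) (c := -(c / 2)) (by linarith)).add
      (haa (-(c / 2)))).add (hbb (-(c / 2)))
    have e : -(-(c / 2) • ((a + b) * (a + b))) + -(c / 2) • (a * a) + -(c / 2) • (b * b)
        = c • (a * b) := by
      ext x
      simp
      ring
    rwa [e] at h

/-! ### Trigonometric modes as multipliers and kicks -/

/-- The function `cos (l · x)`. -/
def cosMode {d : ℕ} (l : Fin d → ℤ) : C(Torus d, ℝ) := ⟨fun x => (expMode l x).re, by fun_prop⟩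

/-- The function `sin (l · x)`. -/
def sinMode {d : ℕ} (l : Fin d → ℤ) : C(Torus d, ℝ) := ⟨fun x => (expMode l x).im, by fun_prop⟩

theorem cosMode_apply {d : ℕ} (l : Fin d → ℤ) (x : Torus d) :
    cosMode l x = (expMode l x).re := rfl

theorem sinMode_apply {d : ℕ} (l : Fin d → ℤ) (x : Torus d) :
    sinMode l x = (expMode l x).im := rfl

theorem coeff_mulL2 {d : ℕ} (m : C(Torus d, ℝ)) (w : L2 d) (k : Fin d → ℤ) :
    coeff (mulL2 m w) k = ∫ x, ((m x : ℝ) : ℂ) * ((w x : ℝ) : ℂ) * (starRingEnd ℂ) (phi k x) := by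
  refine integral_congr_ae ?_
  filter_upwards [coeFn_mulL2 m w] with x hx
  rw [hx]
  push_cast
  ring

theorem expMode_mul_conj_phi {d : ℕ} (l k : Fin d → ℤ) (x : Torus d) :
    expMode l x * (starRingEnd ℂ) (phi k x) = (starRingEnd ℂ) (phi (k - l) x) := by
  rw [conj_phi, conj_phi, expMode_mul_phi]
  congr 2
  abel

theorem coeff_mulL2_cosMode {d : ℕ} (l : Fin d → ℤ) (w : L2 d) (k : Fin d → ℤ) :
    coeff (mulL2 (cosMode l) w) k = (1 / 2) * coeff w (k - l) + (1 / 2) * coeff w (k + l) := by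
  rw [coeff_mulL2, coeff, coeff, ← integral_const_mul, ← integral_const_mul,
    ← integral_add ((integrable_mul_mode w _).const_mul _)
      ((integrable_mul_mode w _).const_mul _)]
  congr 1
  ext x
  have h := expMode_mul_conj_phi (-l) k x
  rw [sub_neg_eq_add] at h
  rw [← expMode_mul_conj_phi l k x, ← h, cosMode_apply, Complex.re_eq_add_conj, conj_expMode]
  ring

theorem coeff_mulL2_sinMode {d : ℕ} (l : Fin d → ℤ) (w : L2 d) (k : Fin d → ℤ) :
    coeff (mulL2 (sinMode l) w) k
      = (1 / (2 * Complex.I)) * coeff w (k - l) + (-1 / (2 * Complex.I)) * coeff w (k + l) := by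
  rw [coeff_mulL2, coeff, coeff, ← integral_const_mul, ← integral_const_mul,
    ← integral_add ((integrable_mul_mode w _).const_mul _)
      ((integrable_mul_mode w _).const_mul _)]
  congr 1
  ext x
  have h := expMode_mul_conj_phi (-l) k x
  rw [sub_neg_eq_add] at h
  rw [← expMode_mul_conj_phi l k x, ← h, sinMode_apply, Complex.im_eq_sub_conj, conj_expMode]
  ring

/-- Peetre's inequality: a frequency shift by l changes the H¹ weight by a bounded factor, so
multiplication by a mode preserves H¹. -/
theorem one_add_eigen_le {d : ℕ} (k l : Fin d → ℤ) :
    1 + eigen k ≤ 2 * (1 + eigen l) * (1 + eigen (k - l)) := by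
  have h : eigen k ≤ 2 * eigen l + 2 * eigen (k - l) := by
    simp only [eigen, Finset.mul_sum, ← Finset.sum_add_distrib, Pi.sub_apply]
    refine Finset.sum_le_sum fun i _ => ?_
    push_cast
    nlinarith [sq_nonneg ((l i : ℝ) - (k i - l i))]
  nlinarith [eigen_nonneg l, eigen_nonneg (k - l),
    mul_nonneg (eigen_nonneg l) (eigen_nonneg (k - l))]

theorem summable_eigen_mul_shift {d : ℕ} (w : H1 d) (l : Fin d → ℤ) :
    Summable fun k => (1 + eigen k) * ‖coeff (H1.incl d w) (k - l)‖ ^ 2 := by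
  have h := ((Equiv.subRight l).summable_iff.2 (H1.hasSum_norm_sq w).summable).mul_left
    (2 * (1 + eigen l))
  refine Summable.of_nonneg_of_le
    (fun k => mul_nonneg (by linarith [eigen_nonneg k]) (sq_nonneg _)) (fun k => ?_) h
  simp only [Function.comp_apply, Equiv.subRight_apply]
  rw [← mul_assoc]
  exact mul_le_mul_of_nonneg_right (one_add_eigen_le k l) (sq_nonneg _)

theorem mem_H1Multiplier_of_coeff {d : ℕ} {m : C(Torus d, ℝ)} {l : Fin d → ℤ} {a b : ℂ}
    (ha : ‖a‖ ≤ 1) (hb : ‖b‖ ≤ 1)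
    (h : ∀ (w : L2 d) (k : Fin d → ℤ),
      coeff (mulL2 m w) k = a * coeff w (k - l) + b * coeff w (k + l)) :
    m ∈ H1Multiplier d := by
  intro w
  refine ⟨H1.mk (mulL2 m (H1.incl d w)) ?_, rfl⟩
  have h1 := summable_eigen_mul_shift w l
  have h2 := summable_eigen_mul_shift w (-l)
  simp only [sub_neg_eq_add] at h2
  refine Summable.of_nonneg_of_le (fun k => mul_nonneg (eigen_nonneg k) (sq_nonneg _))
    (fun k => ?_) ((h1.add h2).mul_left 2)
  rw [h]
  set x := coeff (H1.incl d w) (k - l)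
  set y := coeff (H1.incl d w) (k + l)
  have h3 : ‖a * x + b * y‖ ≤ ‖x‖ + ‖y‖ := by
    refine (norm_add_le _ _).trans ?_
    rw [norm_mul, norm_mul]
    exact add_le_add (mul_le_of_le_one_left (norm_nonneg _) ha)
      (mul_le_of_le_one_left (norm_nonneg _) hb)
  have h4 := (pow_le_pow_left₀ (norm_nonneg _) h3 2).trans (add_sq_le)
  have h5 := mul_le_mul_of_nonneg_left h4 (eigen_nonneg k)
  nlinarith [sq_nonneg ‖x‖, sq_nonneg ‖y‖]

theorem cosMode_mem_H1Multiplier {d : ℕ} (l : Fin d → ℤ) : cosMode l ∈ H1Multiplier d :=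
  mem_H1Multiplier_of_coeff (by norm_num) (by norm_num) (coeff_mulL2_cosMode l)

theorem sinMode_mem_H1Multiplier {d : ℕ} (l : Fin d → ℤ) : sinMode l ∈ H1Multiplier d :=
  mem_H1Multiplier_of_coeff (by norm_num) (by norm_num) (coeff_mulL2_sinMode l)

theorem cosMode_sq_add_sinMode_sq {d : ℕ} (l : Fin d → ℤ) :
    cosMode l * cosMode l + sinMode l * sinMode l = 1 := by
  ext x
  have h := Complex.normSq_eq_norm_sq (expMode l x)
  rw [norm_expMode_apply, one_pow, Complex.normSq_apply] at h
  exact h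

/-- The frequencies whose modes are kickable with every amplitude. -/
def kickFrequencies (d : ℕ) : AddSubgroup (Fin d → ℤ) where
  carrier := {l | cosMode l ∈ kickSpace d ∧ sinMode l ∈ kickSpace d}
  zero_mem' := by
    have hc : cosMode (0 : Fin d → ℤ) = 1 := by
      ext x; rw [cosMode_apply, expMode_zero]; rfl
    have hs : sinMode (0 : Fin d → ℤ) = 0 := by
      ext x; rw [sinMode_apply, expMode_zero]; rfl
    exact ⟨hc ▸ one_mem_kickSpace d, hs ▸ (kickSpace d).zero_mem⟩
  neg_mem' := by
    rintro l ⟨h1, h2⟩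
    have hc : cosMode (-l) = cosMode l := by
      ext x; rw [cosMode_apply, ← conj_expMode]; rfl
    have hs : sinMode (-l) = -sinMode l := by
      ext x; rw [sinMode_apply, ← conj_expMode]; rfl
    exact ⟨hc ▸ h1, hs ▸ (kickSpace d).neg_mem h2⟩
  add_mem' := by
    rintro l l' ⟨h1, h2⟩ ⟨h1', h2'⟩
    have hsq : ∀ {j : Fin d → ℤ}, cosMode j ∈ kickSpace d → sinMode j ∈ kickSpace d →
        cosMode j * cosMode j ∈ kickSpace d ∧ sinMode j * sinMode j ∈ kickSpace d :=
      fun {j} hc hs =>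
        ⟨mul_self_mem_kickSpace hc hs (cosMode_mem_H1Multiplier j) (sinMode_mem_H1Multiplier j)
          (cosMode_sq_add_sinMode_sq j),
        mul_self_mem_kickSpace hs hc (sinMode_mem_H1Multiplier j) (cosMode_mem_H1Multiplier j)
          (by rw [add_comm]; exact cosMode_sq_add_sinMode_sq j)⟩
    obtain ⟨q1, q2⟩ := hsq h1 h2
    obtain ⟨q1', q2'⟩ := hsq h1' h2'
    have mc := cosMode_mem_H1Multiplier (d := d)
    have ms := sinMode_mem_H1Multiplier (d := d)
    -- The addition formulas express the modes at l + l' through products of the modes at l and l'.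
    have hc : cosMode (l + l') = cosMode l * cosMode l' - sinMode l * sinMode l' := by
      ext x
      rw [cosMode_apply, expMode_add, ContinuousMap.mul_apply, Complex.mul_re]; rfl
    have hs : sinMode (l + l') = cosMode l * sinMode l' + sinMode l * cosMode l' := by
      ext x
      rw [sinMode_apply, expMode_add, ContinuousMap.mul_apply, Complex.mul_im]; rfl
    refine ⟨?_, ?_⟩
    · rw [hc]
      exact (kickSpace d).sub_mem (mul_mem_kickSpace h1 h1' (mc _) (mc _) q1 q1')
        (mul_mem_kickSpace h2 h2' (ms _) (ms _) q2 q2')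
    · rw [hs]
      exact (kickSpace d).add_mem (mul_mem_kickSpace h1 h2' (mc _) (ms _) q1 q2')
        (mul_mem_kickSpace h2 h1' (ms _) (mc _) q2 q1')

theorem single_mem_kickFrequencies {d : ℕ} (i : Fin d) : Pi.single i 1 ∈ kickFrequencies d := by
  refine ⟨?_, ?_⟩
  · have h := lowMode_mem_kickSpace (d := d) ⟨2 * i.val + 1, by omega⟩
    convert h using 1
    ext x
    rw [cosMode_apply, expMode_single, lowMode, dif_neg (by simp), if_pos (by simp)]
    simp
  · have h := lowMode_mem_kickSpace (d := d) ⟨2 * i.val + 2, by omega⟩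
    convert h using 1
    ext x
    have hi : (⟨(2 * i.val + 2 - 1) / 2, by omega⟩ : Fin d) = i := Fin.ext (by simp; omega)
    rw [sinMode_apply, expMode_single, lowMode, dif_neg (by simp), if_neg (by simp)]
    simp only [ContinuousMap.coe_mk, hi]

/-- A subgroup of ℤ^d containing the standard basis is the whole group. -/
theorem mem_kickFrequencies {d : ℕ} (l : Fin d → ℤ) : l ∈ kickFrequencies d := by
  rw [← Finset.univ_sum_single l]
  refine sum_mem fun i _ => ?_
  have h : (Pi.single i (l i) : Fin d → ℤ) = l i • Pi.single i 1 := by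
    rw [← Pi.single_smul, smul_eq_mul, mul_one]
  rw [h]
  exact zsmul_mem (single_mem_kickFrequencies i) _

/-! ### Trigonometric polynomials vanish on null sets only -/

/-- The character `s ↦ e^{iωs}` of the real line. -/
def expChar (ω : ℝ) : Multiplicative ℝ →* ℂ where
  toFun s := Complex.exp (((s.toAdd * ω : ℝ) : ℂ) * Complex.I)
  map_one' := by simp
  map_mul' s t := by
    rw [← Complex.exp_add, toAdd_mul]
    congr 1
    push_cast
    ring

theorem expChar_injective : Function.Injective expChar := by
  intro a b h
  by_contra hab
  have hne : a - b ≠ 0 := sub_ne_zero.2 hab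
  -- At s = π / (a - b) the two characters differ by the factor e^{iπ} = -1.
  have h1 := DFunLike.congr_fun h (Multiplicative.ofAdd (π / (a - b)))
  simp only [expChar, MonoidHom.coe_mk, OneHom.coe_mk, toAdd_ofAdd] at h1
  have h2 : ((π / (a - b) * a : ℝ) : ℂ) * Complex.I
      = ((π / (a - b) * b : ℝ) : ℂ) * Complex.I + π * Complex.I := by
    rw [← add_mul, ← Complex.ofReal_add]
    congr 2
    field_simp
    ring
  rw [h2, Complex.exp_add, Complex.exp_pi_mul_I] at h1
  have h3 := Complex.exp_ne_zero (((π / (a - b) * b : ℝ) : ℂ) * Complex.I)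
  apply h3
  linear_combination (-1 / 2 : ℂ) * h1

/-- A nontrivial combination of exponentials with distinct real frequencies has a null zero
set. -/
theorem volume_zeros_exp_sum {ι : Type*} {S : Finset ι} (hS : S.Nonempty) {ω : ι → ℝ}
    (hω : Set.InjOn ω S) {a : ι → ℂ} (ha : ∀ k ∈ S, a k ≠ 0) :
    volume {s : ℝ | ∑ k ∈ S, a k * Complex.exp (((s * ω k : ℝ) : ℂ) * Complex.I) = 0} = 0 := by
  set F : ℝ → ℂ := fun s => ∑ k ∈ S, a k * Complex.exp (((s * ω k : ℝ) : ℂ) * Complex.I) with hF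
  have han : AnalyticOnNhd ℝ F univ := by
    intro s _
    refine Finset.analyticAt_fun_sum _ fun k _ => ?_
    refine analyticAt_const.mul ?_
    have h1 : AnalyticAt ℝ (fun s : ℝ => ((s * ω k : ℝ) : ℂ) * Complex.I) s :=
      ((Complex.ofRealCLM.analyticAt _).comp (analyticAt_id.mul analyticAt_const)).mul
        analyticAt_const
    exact (analyticAt_cexp.restrictScalars (𝕜 := ℝ)).comp h1
  have hne : ∃ s, F s ≠ 0 := by
    by_contra! hzero
    -- Dedekind: distinct characters are linearly independent, so the sum is not identically zero.
    have hind := (linearIndependent_monoidHom (Multiplicative ℝ) ℂ).comp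
      (fun k : S => expChar (ω k)) fun k l hkl =>
        Subtype.ext (hω k.2 l.2 (expChar_injective hkl))
    rw [Fintype.linearIndependent_iff] at hind
    obtain ⟨k, hk⟩ := hS
    refine ha k hk (hind (fun k => a k) ?_ ⟨k, hk⟩)
    funext s
    have h := hzero s.toAdd
    simp only [Finset.sum_apply, Pi.smul_apply, Function.comp_apply, smul_eq_mul, Pi.zero_apply]
    exact (Finset.sum_coe_sort S fun k => a k * expChar (ω k) s).trans h
  obtain ⟨s, hs⟩ := hne
  -- The zeros of an analytic function that is not identically zero are isolated, hence form a null
  -- set.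
  have h1 := han.preimage_zero_mem_codiscrete hs
  have h2 : F ⁻¹' {0}ᶜ ∈ ae (volume.restrict (univ : Set ℝ)) :=
    ae_restrict_le_codiscreteWithin MeasurableSet.univ h1
  rw [Measure.restrict_univ, mem_ae_iff] at h2
  refine measure_mono_null ?_ h2
  exact fun s hs hn => hn hs

/-- Along a line of direction θ the mode k becomes an exponential of real frequency k·θ, which
reduces the torus to one dimension. -/
theorem expMode_line {d : ℕ} (k : Fin d → ℤ) (x : Torus d) (θ : Fin d → ℝ) (s : ℝ) :
    expMode k (x + fun i => ((s * θ i : ℝ) : AddCircle (2 * π)))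
      = expMode k x * Complex.exp (((s * ∑ i, k i * θ i : ℝ) : ℂ) * Complex.I) := by
  have h : ∀ i, fourier (k i) ((x + fun i => ((s * θ i : ℝ) : AddCircle (2 * π))) i)
      = fourier (k i) (x i) * Complex.exp (((s * (k i * θ i) : ℝ) : ℂ) * Complex.I) := by
    intro i
    rw [Pi.add_apply, fourier_apply, smul_add, AddCircle.toCircle_add, Circle.coe_mul,
      ← fourier_apply, ← fourier_apply, fourier_coe_apply]
    congr 2
    have : (π : ℂ) ≠ 0 := Complex.ofReal_ne_zero.2 Real.pi_ne_zero
    push_cast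
    field_simp
  simp only [expMode, ContinuousMap.coe_mk, h, Finset.prod_mul_distrib, ← Complex.exp_sum]
  congr 2
  rw [← Finset.sum_mul, ← Complex.ofReal_sum, ← Finset.mul_sum]

/-- The finitely many differences k - l are nonzero, so some linear functional vanishes on none of
them. -/
theorem exists_separating_direction {d : ℕ} (S : Finset (Fin d → ℤ)) :
    ∃ θ : Fin d → ℝ, Set.InjOn (fun k : Fin d → ℤ => ∑ i, (k i : ℝ) * θ i) S := by
  let v : {q : S × S // q.1 ≠ q.2} → (Fin d → ℝ) := fun q i => ((q.1.1.1 i - q.1.2.1 i : ℤ) : ℝ)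
  have hv : ∀ q, v q ≠ 0 := fun q h => q.2 (Subtype.ext (funext fun i => by
    have := congrFun h i
    simp only [v, Pi.zero_apply, Int.cast_eq_zero] at this
    exact sub_eq_zero.1 this))
  obtain ⟨f, hf⟩ := Module.exists_dual_forall_apply_ne_zero (K := ℝ) v hv
  refine ⟨fun i => f (Pi.single i 1), fun k hk l hl hkl => ?_⟩
  by_contra hne
  refine hf ⟨(⟨k, hk⟩, ⟨l, hl⟩), fun h => hne (congrArg Subtype.val h)⟩ ?_
  rw [LinearMap.pi_apply_eq_sum_univ f]
  have h2 := sub_eq_zero.2 hkl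
  rw [← Finset.sum_sub_distrib] at h2
  refine Eq.trans (Finset.sum_congr rfl fun i _ => ?_) h2
  have e : (fun j => if i = j then (1 : ℝ) else 0) = Pi.single i 1 := by
    funext j
    rw [Pi.single_apply]
    simp only [eq_comm]
  rw [e]
  simp only [v, smul_eq_mul]
  push_cast
  ring

/-- The zero set of a nonzero trigonometric polynomial is a null set. -/
theorem volume_zeros_trigPoly {d : ℕ} {S : Finset (Fin d → ℤ)} (hS : S.Nonempty)
    {a : (Fin d → ℤ) → ℂ} (ha : ∀ k ∈ S, a k ≠ 0) :
    volume {x : Torus d | ∑ k ∈ S, a k * expMode k x = 0} = 0 := by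
  obtain ⟨θ, hθ⟩ := exists_separating_direction S
  set Z : Set (Torus d) := {x | ∑ k ∈ S, a k * expMode k x = 0} with hZ
  let γ : ℝ → Torus d := fun s i => ((s * θ i : ℝ) : AddCircle (2 * π))
  have hγ : Continuous γ := continuous_pi fun i =>
    (AddCircle.continuous_mk' _).comp (continuous_id.mul continuous_const)
  have hZc : IsClosed Z := isClosed_eq (by fun_prop) continuous_const
  -- Fubini on the translates of Z along the line: the slices at fixed x are null, while the slices
  -- at fixed s are translates of Z. Hence |Z| · ∞ = 0.
  let N : Set (Torus d × ℝ) := {q | q.1 + γ q.2 ∈ Z}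
  have hN : MeasurableSet N :=
    (hZc.preimage (continuous_fst.add (hγ.comp continuous_snd))).measurableSet
  have h1 : (volume.prod volume : Measure (Torus d × ℝ)) N = 0 := by
    rw [Measure.measure_prod_null hN]
    refine Eventually.of_forall fun x => ?_
    have h := volume_zeros_exp_sum hS hθ (a := fun k => a k * expMode k x) fun k hk =>
      mul_ne_zero (ha k hk) (norm_ne_zero_iff.1 (by rw [norm_expMode_apply]; exact one_ne_zero))
    refine (congrArg volume ?_).trans h
    ext s
    change ∑ k ∈ S, a k * expMode k (x + γ s) = 0 ↔ _
    simp only [γ, expMode_line, mul_assoc]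
    rfl
  rw [Measure.prod_apply_symm hN] at h1
  have h2 : ∀ s : ℝ, volume ((fun x => (x, s)) ⁻¹' N) = volume Z := fun s =>
    measure_preimage_add_right volume (γ s) Z
  simp only [h2, lintegral_const, Real.volume_univ] at h1
  rcases mul_eq_zero.1 h1 with h | h
  · exact h
  · exact absurd h ENNReal.top_ne_zero

theorem ae_eq_trigPoly {d : ℕ} (w : L2 d)
    (hfin : {k : Fin d → ℤ | coeff w k ≠ 0}.Finite) :
    ∃ q : C(Torus d, ℝ), w =ᵐ[volume] q ∧
      ∀ x, ((q x : ℝ) : ℂ) = ∑ k ∈ hfin.toFinset, coeff w k * phi k x := by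
  have h1 : HasSum (fun k => (1 : ℝ) • part w k) w := hasSum_part (fun _ => rfl) fun k =>
    (one_smul _ _).symm
  have h2 : HasSum (fun k => (1 : ℝ) • part w k)
      (∑ k ∈ hfin.toFinset, (1 : ℝ) • part w k) := hasSum_sum_of_ne_finset_zero fun k hk => by
    have hk : coeff w k = 0 := by simpa using hk
    rw [one_smul]
    refine ext_coeff fun j => ?_
    rw [coeff_part, coeff_zero]
    by_cases h1 : k = j
    · rw [← h1, hk, mul_zero]
    · by_cases h2 : k = -j
      · have : coeff w j = 0 := by rw [← neg_neg j, ← h2, coeff_neg_index, hk, map_zero]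
        rw [this, mul_zero]
      · rw [if_neg h1, if_neg h2]; simp
  let q : C(Torus d, ℝ) := ∑ k ∈ hfin.toFinset, ⟨fun x => (coeff w k * phi k x).re, by fun_prop⟩
  have h3 : w = ContinuousMap.toLp 2 volume ℝ q := by
    rw [h1.unique h2, map_sum]
    refine Finset.sum_congr rfl fun k _ => ?_
    rw [one_smul]
    rfl
  refine ⟨q, ?_, fun x => ?_⟩
  · conv_lhs => rw [h3]
    exact ContinuousMap.coeFn_toLp volume q
  · have h4 : q x = (∑ k ∈ hfin.toFinset, coeff w k * phi k x).re := by
      rw [Complex.re_sum, ContinuousMap.sum_apply]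
      rfl
    rw [h4]
    -- The sum is real, since conjugation permutes its terms by k ↦ -k.
    refine Complex.conj_eq_iff_re.1 ?_
    rw [map_sum]
    refine Finset.sum_nbij' (fun k => -k) (fun k => -k) ?_ ?_ (by simp) (by simp) ?_
    · intro k hk
      simpa [coeff_neg_index] using hk
    · intro k hk
      simpa [coeff_neg_index] using hk
    · intro k _
      rw [map_mul, conj_phi, coeff_neg_index]

/-- The products of a nonzero trigonometric polynomial with the Fourier modes span a dense
subspace of `L²`. -/
theorem topologicalClosure_eq_top_of_modes {d : ℕ} {w : L2 d} (hw : w ≠ 0)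
    (hfin : {k : Fin d → ℤ | coeff w k ≠ 0}.Finite) {V : Submodule ℝ (L2 d)}
    (hV : ∀ l, mulL2 (cosMode l) w ∈ V ∧ mulL2 (sinMode l) w ∈ V) :
    V.topologicalClosure = ⊤ := by
  rw [Submodule.topologicalClosure_eq_top_iff, Submodule.eq_bot_iff]
  intro h hh
  rw [Submodule.mem_orthogonal] at hh
  obtain ⟨q, hwq, hq⟩ := ae_eq_trigPoly w hfin
  have hmul : ∀ m : C(Torus d, ℝ), mulL2 m w ∈ V → ∫ x, m x * (q x * h x) = 0 := fun m hm => by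
    rw [← hh _ hm, L2.inner_def]
    refine integral_congr_ae ?_
    filter_upwards [hwq, coeFn_mulL2 m w] with x h1 h2
    rw [h2, h1]
    change _ = h x * (m x * q x)
    ring
  -- Orthogonality to all cosine and sine multiples of w says that every Fourier coefficient of q h
  -- vanishes.
  have hzero : mulL2 q h = 0 := by
    refine ext_coeff fun k => ?_
    rw [coeff_zero, coeff_mulL2]
    have hint : ∀ m : C(Torus d, ℝ), Integrable fun x => ((m x * (q x * h x) : ℝ) : ℂ) := fun m =>
      (((Lp.memLp h).integrable (by norm_num)).bdd_mul (c := ‖m * q‖)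
        (m * q).continuous.aestronglyMeasurable
        (Eventually.of_forall fun x => (m * q).norm_coe_le_norm x)).ofReal.congr
        (Eventually.of_forall fun x => by simp [mul_assoc])
    have e : ∀ x, ((q x : ℝ) : ℂ) * ((h x : ℝ) : ℂ) * (starRingEnd ℂ) (phi k x)
        = (((2 * π) ^ (-(d : ℝ) / 2) : ℝ) : ℂ) * (((cosMode k x * (q x * h x) : ℝ) : ℂ)
          - Complex.I * ((sinMode k x * (q x * h x) : ℝ) : ℂ)) := by
      intro x
      have e1 : (starRingEnd ℂ) (expMode k x)
          = ((cosMode k x : ℝ) : ℂ) - Complex.I * ((sinMode k x : ℝ) : ℂ) := by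
        rw [cosMode_apply, sinMode_apply]
        apply Complex.ext <;> simp
      rw [phi_apply, map_mul, Complex.conj_ofReal, e1]
      push_cast
      ring
    simp_rw [e]
    rw [integral_const_mul, integral_sub (hint _) ((hint _).const_mul _), integral_const_mul,
      integral_complex_ofReal, integral_complex_ofReal, hmul _ (hV k).1, hmul _ (hV k).2]
    simp
  have hS : hfin.toFinset.Nonempty := by
    rw [Finset.nonempty_iff_ne_empty]
    intro hempty
    refine hw (ext_coeff fun k => ?_)
    rw [coeff_zero]
    by_contra hk
    have : k ∈ hfin.toFinset := by simpa using hk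
    rw [hempty] at this
    exact Finset.notMem_empty _ this
  have hr : (((2 * π) ^ (-(d : ℝ) / 2) : ℝ) : ℂ) ≠ 0 :=
    Complex.ofReal_ne_zero.2 (Real.rpow_pos_of_pos Real.two_pi_pos _).ne'
  have hnull := volume_zeros_trigPoly hS
    (a := fun k => coeff w k * (((2 * π) ^ (-(d : ℝ) / 2) : ℝ) : ℂ)) fun k hk =>
      mul_ne_zero (by simpa using hk) hr
  have hqne : ∀ᵐ x, q x ≠ 0 := by
    rw [ae_iff]
    refine measure_mono_null (fun x hx => ?_) hnull
    have hx : q x = 0 := by simpa using hx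
    have h1 := hq x
    rw [hx, Complex.ofReal_zero] at h1
    simp only [phi_apply, ← mul_assoc] at h1
    exact h1.symm
  refine Lp.ext ?_
  have h0 : mulL2 q h =ᵐ[volume] (0 : Torus d → ℝ) := by
    rw [hzero]
    exact Lp.coeFn_zero _ _ _
  filter_upwards [h0, coeFn_mulL2 q h, hqne, Lp.coeFn_zero ℝ 2 (volume : Measure (Torus d))]
    with x h1 h2 h3 h4
  rw [h4]
  rw [h2] at h1
  exact (mul_eq_zero.1 h1).resolve_left h3

/-! ### Approximate control of the velocity -/

/-- The velocity increments, with all their multiples, that are reachable at the profile `w` in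
arbitrarily small time. -/
def velocitySpace {d : ℕ} (w : H1 d) : Submodule ℝ (L2 d) where
  carrier := {g | ∀ (c : ℝ), ∀ T > 0, ∀ v : L2 d,
    ReachIn (freeFlowL d) (controlL d) T (w, v) (w, v + c • g)}
  add_mem' {g g'} hg hg' c T hT v := by
    have h := (hg c (T / 2) (half_pos hT) v).trans (hg' c (T / 2) (half_pos hT) (v + c • g))
    rwa [add_halves, add_assoc, ← smul_add] at h
  zero_mem' c T hT v := by
    intro ε hε
    exact ⟨0, hT.le, id, Flow.refl, by simpa using hε⟩
  smul_mem' a g hg c T hT v := by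
    rw [smul_smul]
    exact hg _ T hT v

theorem mulL2_mem_velocitySpace {d : ℕ} {m : C(Torus d, ℝ)} (hm : m ∈ kickSpace d) (w : H1 d) :
    mulL2 m (H1.incl d w) ∈ velocitySpace w := by
  intro c T hT v
  have h := hm c T hT (w, v)
  have e : ((w, v) : H1 d × L2 d) + kick d (c • m) (w, v)
      = (w, v + c • mulL2 m (H1.incl d w)) := by
    rw [kick_apply, mulL2_smul_left, Prod.mk_add_mk, add_zero]
  rwa [e] at h

/-- The reachable increments are dense in L², so f - v is approximated by one of them; approximate
reachability is closed under limits of targets. -/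
theorem reachIn_velocity {d : ℕ} {w : H1 d} (hw : w ≠ 0)
    (hfin : {k : Fin d → ℤ | coeff (H1.incl d w) k ≠ 0}.Finite) (v f : L2 d) {T : ℝ}
    (hT : 0 < T) : ReachIn (freeFlowL d) (controlL d) T (w, v) (w, f) := by
  have hincl : H1.incl d w ≠ 0 := fun h => hw (H1.incl_injective d (h.trans (map_zero _).symm))
  have htop := topologicalClosure_eq_top_of_modes hincl hfin (V := velocitySpace w) fun l =>
    ⟨mulL2_mem_velocitySpace (mem_kickFrequencies l).1 w,
      mulL2_mem_velocitySpace (mem_kickFrequencies l).2 w⟩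
  have hmem : f - v ∈ (velocitySpace w).topologicalClosure := by
    rw [htop]; exact Submodule.mem_top
  refine ReachIn.of_approx fun ε hε => ?_
  obtain ⟨g, hg, hdist⟩ := Metric.mem_closure_iff.1 hmem ε hε
  have h1 := hg 1 T hT v
  rw [one_smul] at h1
  refine ⟨_, h1, ?_⟩
  rw [Prod.mk_sub_mk, sub_self, Prod.norm_mk, norm_zero, max_eq_right (norm_nonneg _)]
  rw [dist_eq_norm, norm_sub_rev] at hdist
  have e : v + g - f = g - (f - v) := by abel
  rwa [e]

end

end BilinearWave

theorem mainTheorem4 (d : ℕ) (w₀ : BilinearWave.H1 d) (v₀ f : BilinearWave.L2 d)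
    (hw₀ : w₀ ≠ 0)
    (hfin : {k : Fin d → ℤ | BilinearWave.coeff (BilinearWave.H1.incl d w₀) k ≠ 0}.Finite)
    (ε T : ℝ) (hε : 0 < ε) (hT : 0 < T) :
    ∃ τ ∈ Set.Ico 0 T, ∃ p : ℝ → Fin (2 * d + 1) → ℝ,
      BilinearWave.IsPiecewiseConstant τ p ∧
      (∃ W, BilinearWave.IsWeakSolution τ p (w₀, v₀) W) ∧
      ∀ W, BilinearWave.IsWeakSolution τ p (w₀, v₀) W →
        √(‖(W τ).1 - w₀‖ ^ 2 + ‖(W τ).2 - f‖ ^ 2) < ε := by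
  -- T/2 makes τ < T strict. The product norm is the maximum, so ε/2 in each component keeps the
  -- Euclidean norm below ε/√2.
  obtain ⟨τ, hτT, L, hL, hclose⟩ := BilinearWave.reachIn_velocity hw₀ hfin v₀ f (half_pos hT) (ε / 2)
    (half_pos hε)
  have hτ := hL.nonneg
  obtain ⟨p, hp, ⟨C, hC⟩, hsol⟩ := hL.exists_control (BilinearWave.isStrongGroup_freeFlowL d)
  obtain ⟨W₁, hW₁, hLW⟩ := hsol (w₀, v₀)
  refine ⟨τ, ⟨hτ, by linarith⟩, p, hp, ⟨W₁, BilinearWave.isMild_iff_isWeakSolution.1 hW₁⟩, fun W hW => ?_⟩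
  -- By uniqueness an arbitrary solution ends where the constructed one does.
  have h1 := (BilinearWave.isMild_iff_isWeakSolution.2 hW).unique (BilinearWave.isStrongGroup_freeFlowL d) hτ hC hW₁ τ
    ⟨hτ, le_rfl⟩
  rw [h1, hLW]
  have h2 : ‖(L (w₀, v₀)).1 - w₀‖ < ε / 2 := (norm_fst_le (L (w₀, v₀) - (w₀, f))).trans_lt hclose
  have h3 : ‖(L (w₀, v₀)).2 - f‖ < ε / 2 := (norm_snd_le (L (w₀, v₀) - (w₀, f))).trans_lt hclose
  rw [Real.sqrt_lt' hε]
  nlinarith [norm_nonneg ((L (w₀, v₀)).1 - w₀), norm_nonneg ((L (w₀, v₀)).2 - f)]
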